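/- **Model.** Risk types $\theta\in\Theta=[\underline\theta,\bar\theta]$ have a continuous density $f>0$ and distribution function $F$. The valuation of type $\theta$ lies in $B=[0,\bar b)$, $0<\bar b\le\infty$, and has distribution function $H_\theta$ (an atom at $0$ is allowed; $H_\theta=1$ on $[\bar b,\infty)$), where $H_\theta$ increases in $\theta$ in first-order stochastic dominance, is $C^1$ in $\theta$ and $C^1$ in $b\in B$ with $h_\theta=\partial H_\theta/\partial b>0$, and has a continuous cross partial derivative $\partial^2H_\theta(b)/\partial b\,\partial\theta$ on $\Theta\times B$. The distortion $g:[0,1]\to[0,1]$ is non-decreasing and $C^1$ with $g(q)\le q$, $g(0)=0$, $g(1)=1$. Supply $S:\mathbb R_+\to\mathbb R_+$ is strictly increasing, $C^1$ and unbounded, with $S(0)=0$. Uninsured agents pay the price $\beta+p$, $\beta\ge 0$. Put $$J_1(\theta,b)=1-g(H_\theta(b))+\tfrac{1-F(\theta)}{f(\theta)}\,g'(H_\theta(b))\,\tfrac{\partial H_\theta(b)}{\partial\theta},\qquad J(\theta,b)=\frac{J_1(\theta,b)}{h_\theta(b)}+b-p-\frac{1-H_\theta(b)}{h_\theta(b)},$$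 $RS(p)=S(p)-\int_\Theta[1-H_\theta(p)]f(\theta)\,d\theta$ and $K(p)=\int_p^{\beta+p}[1-g(H_{\underline\theta}(b))]\,db$. For a price $p$, the first-stage problem is to maximize $$\int_\Theta\int_0^p x(\theta,b)J(\theta,b)h_\theta(b)\,db\,f(\theta)\,d\theta+K(p)$$ over measurable $x$ with values in $[0,1]$ and $x(\theta,\cdot)$ non-decreasing on $B$, subject to the equilibrium constraint $$\int_\Theta\int_0^p x(\theta,b)h_\theta(b)\,db\,f(\theta)\,d\theta=RS(p).\tag{EQ}$$ Its value is $\Pi(p)$. Let $p^N>0$ and $p^F>0$ be the prices at which (EQ) holds with $x\equiv0$ and with $x\equiv1$ respectively, and suppose $p^F<\bar b$. A profit-maximizing service price $p^*$ is a maximizer of $\Pi$ over $[p^N,p^F]$. The price-taking benchmark $p^U\in[p^N,p^F]$ is the price at which some solution of the first-stage problem without (EQ) satisfies (EQ). A simple deductible profile $D:\Theta\to[0,p]$ is optimal at $p$ if $x(\theta,b)=\mathbf 1[b>D(\theta)]$ solves the first-stage problem at $p$. For a profile $D$ that is optimal at $p^U$, the surplus extraction force and the cost effect at $p^U$ are $$\mathrm{SE}=\int_\Theta\mathbf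 1[D(\theta)<p^U]\,J_1(\theta,p^U)f(\theta)\,d\theta,\qquad \mathrm{CE}=\int_\Theta\mathbf 1[D(\theta)<p^U]\,(1-H_\theta(D(\theta)))f(\theta)\,d\theta.$$ The dual problem at $p$ is to minimize $\int_\Theta v f\,d\theta$ over $(v,\lambda)\in L^1(f)\times\mathbb R$ such that, for almost every $\theta$, $v(\theta)\ge\max_{q\in[0,1]}\Phi(\theta,q)+\lambda([H_\theta(p)-H_\theta(0)]q-RS(p))$. Here $\Phi(\theta,q)=[H_\theta(p)-H_\theta(0)]\int_0^qJ(\theta,b_\theta(s))\,ds$, and $b_\theta(s)\in[0,p]$ is the point where $\frac{H_\theta(b)-H_\theta(0)}{H_\theta(p)-H_\theta(0)}=1-s$. **Proposition.** Assume $\beta=0$ and, for all $\theta$, that on $B$ the function $J(\theta,\cdot)$ is strictly increasing, $J_1(\theta,\cdot)$ is non-increasing and $H_\theta$ is concave. Let $p^U$ be a price-taking benchmark. Then: 1. $\lambda^*=0$ is an optimal multiplier at $p^U$, that is, $(v,0)$ solves the dual problem at $p^U$ for some $v$. 2. $\Pi$ is differentiable on $[p^N,p^F]$ (one-sidedly at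 the end points), and an optimal simple deductible profile exists at $p^U$. For every such profile, if $p^N<p^U<p^F$, then $\Pi'(p^U)=\mathrm{SE}-\mathrm{CE}$. 3. For $p\in[p^N,p^F]$: if $p<p^U$, then $\Pi'(p)>\mathrm{SE}-\mathrm{CE}$; if $p>p^U$, then $\Pi'(p)<\mathrm{SE}-\mathrm{CE}$. In particular, at an interior benchmark, $\Pi'$ is strictly larger below $p^U$ than at $p^U$, and strictly smaller above it. 4. Every profit-maximizing service price $p^*$ satisfies: - if $\mathrm{SE}>\mathrm{CE}$, then $p^*>p^U$ when $p^U<p^F$, and $p^*=p^U$ when $p^U=p^F$; - if $\mathrm{SE}<\mathrm{CE}$ and $p^U<p^F$, then $p^*<p^U$; - if $\mathrm{SE}=\mathrm{CE}$, then $p^*=p^U$. -/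

import Mathlib

open Set MeasureTheory

noncomputable section

/-- The primitives of the insurance model, with their standing assumptions.  Partial derivatives are
carried as functions that are pinned down by `HasDerivWithinAt` on the domain of the primitive. -/
structure InsuranceModel where
  /-- lowest and highest risk type -/
  θlo : ℝ
  θhi : ℝ
  θlo_lt_θhi : θlo < θhi
  /-- supremum of the valuations, finite or infinite; valuations lie in `[0, bbar)` -/
  bbar : EReal
  bbar_pos : 0 < bbar
  /-- density of risk types -/
  f : ℝ → ℝ
  f_cont : ContinuousOn f (Icc θlo θhi)
  f_pos : ∀ θ ∈ Icc θlo θhi, 0 < f θ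
  f_integral : ∫ θ in θlo..θhi, f θ = 1
  /-- `H θ` is the distribution function of the valuation of risk type `θ` (an atom at `0` is
  allowed), extended by `1` to the right of `[0, bbar)` -/
  H : ℝ → ℝ → ℝ
  H_mem : ∀ θ ∈ Icc θlo θhi, ∀ b : ℝ, 0 ≤ b → (b : EReal) < bbar → H θ b ∈ Icc (0 : ℝ) 1
  H_lub : ∀ θ ∈ Icc θlo θhi, IsLUB (H θ '' {b : ℝ | 0 ≤ b ∧ (b : EReal) < bbar}) 1
  H_right : ∀ θ ∈ Icc θlo θhi, ∀ b : ℝ, bbar ≤ (b : EReal) → H θ b = 1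
  /-- higher risk types have higher valuations (first-order stochastic dominance) -/
  H_fosd : ∀ b : ℝ, 0 ≤ b → (b : EReal) < bbar → AntitoneOn (fun θ => H θ b) (Icc θlo θhi)
  /-- `h θ` is the derivative of `H θ` on `[0, bbar)` -/
  h : ℝ → ℝ → ℝ
  h_deriv : ∀ θ ∈ Icc θlo θhi, ∀ b : ℝ, 0 ≤ b → (b : EReal) < bbar →
    HasDerivWithinAt (H θ) (h θ b) {b : ℝ | 0 ≤ b ∧ (b : EReal) < bbar} b
  h_cont : ∀ θ ∈ Icc θlo θhi, ContinuousOn (h θ) {b : ℝ | 0 ≤ b ∧ (b : EReal) < bbar}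
  h_pos : ∀ θ ∈ Icc θlo θhi, ∀ b : ℝ, 0 ≤ b → (b : EReal) < bbar → 0 < h θ b
  /-- `Hθ θ b` is the derivative of `H θ b` in the risk type -/
  Hθ : ℝ → ℝ → ℝ
  Hθ_deriv : ∀ θ ∈ Icc θlo θhi, ∀ b : ℝ, 0 ≤ b → (b : EReal) < bbar →
    HasDerivWithinAt (fun t => H t b) (Hθ θ b) (Icc θlo θhi) θ
  Hθ_cont : ∀ b : ℝ, 0 ≤ b → (b : EReal) < bbar →
    ContinuousOn (fun θ => Hθ θ b) (Icc θlo θhi)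
  /-- `Hbθ θ b` is the cross partial derivative of `H` -/
  Hbθ : ℝ → ℝ → ℝ
  Hbθ_deriv : ∀ θ ∈ Icc θlo θhi, ∀ b : ℝ, 0 ≤ b → (b : EReal) < bbar →
    HasDerivWithinAt (Hθ θ) (Hbθ θ b) {b : ℝ | 0 ≤ b ∧ (b : EReal) < bbar} b
  Hbθ_cont : ContinuousOn (Function.uncurry Hbθ)
    (Icc θlo θhi ×ˢ {b : ℝ | 0 ≤ b ∧ (b : EReal) < bbar})
  /-- probability distortion function of the dual utility, and its derivative -/
  g : ℝ → ℝ
  g' : ℝ → ℝ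
  g_mem : ∀ q ∈ Icc (0 : ℝ) 1, g q ∈ Icc (0 : ℝ) 1
  g_mono : MonotoneOn g (Icc 0 1)
  g_deriv : ∀ q ∈ Icc (0 : ℝ) 1, HasDerivWithinAt g (g' q) (Icc 0 1) q
  g'_cont : ContinuousOn g' (Icc 0 1)
  g_le : ∀ q ∈ Icc (0 : ℝ) 1, g q ≤ q
  g_zero : g 0 = 0
  g_one : g 1 = 1
  /-- supply of services, and its derivative -/
  S : ℝ → ℝ
  S' : ℝ → ℝ
  S_strictMono : StrictMonoOn S (Ici 0)
  S_deriv : ∀ p ∈ Ici (0 : ℝ), HasDerivWithinAt S (S' p) (Ici 0) p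
  S'_cont : ContinuousOn S' (Ici 0)
  S_unbounded : ∀ c : ℝ, ∃ p : ℝ, 0 ≤ p ∧ c < S p
  S_zero : S 0 = 0
  /-- uninsured agents pay the price `β + p` -/
  β : ℝ
  β_nonneg : 0 ≤ β

namespace InsuranceModel

variable (M : InsuranceModel)

/-- The set of risk types. -/
def Θ : Set ℝ := Icc M.θlo M.θhi

/-- The set `[0, bbar)` of valuations. -/
def B : Set ℝ := {b : ℝ | 0 ≤ b ∧ (b : EReal) < M.bbar}

/-- Distribution function of risk types. -/
def F (θ : ℝ) : ℝ := ∫ t in M.θlo..θ, M.f t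

/-- Period-1 virtual value. -/
def J1 (θ b : ℝ) : ℝ :=
  1 - M.g (M.H θ b) + (1 - M.F θ) / M.f θ * M.g' (M.H θ b) * M.Hθ θ b

/-- The virtual value at service price `p`: period-1 plus period-2 virtual value. -/
def J (p θ b : ℝ) : ℝ :=
  M.J1 θ b / M.h θ b + (b - p - (1 - M.H θ b) / M.h θ b)

/-- Demand that is generated by valuations in `[0, p]` under the allocation `x`. -/
def insuredDemand (x : ℝ → ℝ → ℝ) (p : ℝ) : ℝ :=
  ∫ θ in M.θlo..M.θhi, (∫ b in (0 : ℝ)..p, x θ b * M.h θ b) * M.f θ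

/-- Demand of the agents with valuation above `p`, who always seek the service. -/
def baseDemand (p : ℝ) : ℝ := ∫ θ in M.θlo..M.θhi, (1 - M.H θ p) * M.f θ

/-- Total demand for services at price `p`. -/
def demand (x : ℝ → ℝ → ℝ) (p : ℝ) : ℝ := M.insuredDemand x p + M.baseDemand p

/-- Residual supply. -/
def RS (p : ℝ) : ℝ := M.S p - M.baseDemand p

/-- `p` clears the service market when nobody is covered. -/
def IsNoCoveragePrice (p : ℝ) : Prop := 0 < p ∧ M.demand (fun _ _ => 0) p = M.S p

/-- `p` clears the service market when everybody is fully covered. -/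
def IsFullCoveragePrice (p : ℝ) : Prop := 0 < p ∧ M.demand (fun _ _ => 1) p = M.S p

/-- Payoff of risk type `θ` outside the mechanism. -/
def UNP (p θ : ℝ) : ℝ := -∫ b in (0 : ℝ)..(M.β + p), (1 - M.g (M.H θ b))

/-- The part of the insurer's profit that does not depend on the allocation. -/
def K (p : ℝ) : ℝ :=
  -M.UNP p M.θlo - ∫ b in (0 : ℝ)..p, (1 - M.g (M.H M.θlo b))

/-- The insurer's profit at price `p` under the allocation `x`. -/
def objective (p : ℝ) (x : ℝ → ℝ → ℝ) : ℝ :=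
  (∫ θ in M.θlo..M.θhi, (∫ b in (0 : ℝ)..p, x θ b * M.J p θ b * M.h θ b) * M.f θ) + M.K p

/-- (MON): a measurable `[0, 1]`-valued allocation, non-decreasing in the valuation. -/
def IsMonotoneAllocation (x : ℝ → ℝ → ℝ) : Prop :=
  Measurable (Function.uncurry x) ∧
    ∀ θ ∈ M.Θ, (∀ b ∈ M.B, x θ b ∈ Icc (0 : ℝ) 1) ∧ MonotoneOn (x θ) M.B

/-- Feasibility in the first-stage problem: (MON) and the equilibrium constraint (EQ). -/
def IsFeasible (p : ℝ) (x : ℝ → ℝ → ℝ) : Prop :=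
  M.IsMonotoneAllocation x ∧ M.insuredDemand x p = M.RS p

/-- `x` solves the first-stage problem at price `p`. -/
def SolvesFirstStage (p : ℝ) (x : ℝ → ℝ → ℝ) : Prop :=
  M.IsFeasible p x ∧ ∀ y, M.IsFeasible p y → M.objective p y ≤ M.objective p x

/-- `x` solves the first-stage problem at price `p` without the equilibrium constraint. -/
def SolvesUnconstrained (p : ℝ) (x : ℝ → ℝ → ℝ) : Prop :=
  M.IsMonotoneAllocation x ∧
    ∀ y, M.IsMonotoneAllocation y → M.objective p y ≤ M.objective p x

/-- The value `Π(p)` of the first-stage problem. -/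
def profit (p : ℝ) : ℝ := sSup (M.objective p '' {x | M.IsFeasible p x})

/-- `p` solves the second-stage problem on the interval of prices `[pN, pF]`. -/
def SolvesSecondStage (pN pF p : ℝ) : Prop :=
  p ∈ Icc pN pF ∧ ∀ r ∈ Icc pN pF, M.profit r ≤ M.profit p

/-- Price-taking benchmark: the price clears the service market for an allocation that solves the
first-stage problem without the equilibrium constraint. -/
def IsPriceTakingBenchmark (p : ℝ) : Prop :=
  ∃ x, M.SolvesUnconstrained p x ∧ M.demand x p = M.S p

/-- The allocation under which each type `θ` has the simple deductible contract `{(1, D θ)}`. -/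
def deductibleAllocation (D : ℝ → ℝ) : ℝ → ℝ → ℝ := fun θ b => if D θ < b then 1 else 0

/-- `D` is an optimal profile of simple deductibles at price `p`. -/
def IsOptimalDeductible (p : ℝ) (D : ℝ → ℝ) : Prop :=
  (∀ θ ∈ M.Θ, D θ ∈ Icc 0 p) ∧ M.SolvesFirstStage p (deductibleAllocation D)

/-- Surplus extraction force at `p`: virtual value extracted at the margin from covered types. -/
def surplusExtraction (p : ℝ) (D : ℝ → ℝ) : ℝ :=
  ∫ θ in M.θlo..M.θhi, (if D θ < p then M.J1 θ p else 0) * M.f θ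

/-- Cost effect force at `p`: marginal payouts to covered types. -/
def costEffect (p : ℝ) (D : ℝ → ℝ) : ℝ :=
  ∫ θ in M.θlo..M.θhi, (if D θ < p then 1 - M.H θ (D θ) else 0) * M.f θ

/-! The dual of the first-stage problem in the quantity space. -/

/-- Distribution function of the valuation of type `θ` conditional on lying in `(0, p]`. -/
def condH (p θ b : ℝ) : ℝ := (M.H θ b - M.H θ 0) / (M.H θ p - M.H θ 0)

/-- The valuation `b_θ(q)`, the inverse of the conditional distribution function at `1 - q`. -/
def bq (p θ q : ℝ) : ℝ := sInf {b : ℝ | b ∈ Icc 0 p ∧ 1 - q ≤ M.condH p θ b}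

/-- Profit from serving the fraction `q` of the agents of type `θ` with valuation in `(0, p]`. -/
def Φ (p θ q : ℝ) : ℝ :=
  (M.H θ p - M.H θ 0) * ∫ s in (0 : ℝ)..q, M.J p θ (M.bq p θ s)

/-- The constraint of the dual problem. -/
def IsDualFeasible (p : ℝ) (v : ℝ → ℝ) (l : ℝ) : Prop :=
  IntegrableOn (fun θ => v θ * M.f θ) M.Θ ∧
    ∀ᵐ θ ∂(volume.restrict M.Θ), ∀ q ∈ Icc (0 : ℝ) 1,
      M.Φ p θ q + l * ((M.H θ p - M.H θ 0) * q - M.RS p) ≤ v θ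

/-- `(v, l)` solves the dual problem at price `p`; `l` is the multiplier of (EQ). -/
def SolvesDual (p : ℝ) (v : ℝ → ℝ) (l : ℝ) : Prop :=
  M.IsDualFeasible p v l ∧ ∀ w m, M.IsDualFeasible p w m →
    ∫ θ in M.θlo..M.θhi, v θ * M.f θ ≤ ∫ θ in M.θlo..M.θhi, w θ * M.f θ

end InsuranceModel

end

/-! Lagrangian duality in the level `c` of virtual value that earns coverage. With `β = 0` the
constant `K` vanishes and `J p = J 0 - p`. For every `c`, the objective at a feasible allocation is
at most G(p, c) = `surplus p c + (c - p) * RS p`; equality holds exactly when almost all valuations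
below p with `J 0 > c`, and no others, are served. Strict monotonicity of `J` makes this rule a
deductible. Hence Π(p) = min over c of G(p, c), attained at any c whose served mass equals `RS p`
(`profit_eq`, `profit_le`). The multiplier of (EQ) is p - c, so a price-taking benchmark is a price
cleared by c = p.

Within the range of virtual values the clearing level c(p) is unique and therefore continuous
(`continuousOn_clearing`), and the envelope theorem gives Π'(p) = ∂G/∂p = `margin p (c p)`. Two
monotonicities finish the comparison. The margin rises with c, since the excess over c falls at a
rate of at most the mass at p (`margin_self_le`, `margin_le_self`). On the diagonal it equals ∫
max(J1, 1 - H) f - S, which strictly decreases in p (`margin_self_eq`, `margin_self_strictAntiOn`).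
Total demand falls in p and c while supply rises, so c(p) ≥ p below the benchmark and c(p) ≤ p above
it; thus Π' lies above, respectively below, the diagonal margin at pU.

That margin is SE - CE: the types with D < pU are almost surely those with J1 > 1 - H at pU, supply
equals ∫ (1 - H(D)) f, and the remaining types cancel. The location of the maximizer follows from
the sign of Π' on either side of pU. -/

noncomputable section

/-! ### Joint continuity of the primitives -/

/-- Projection of the line onto `[a, b]`. -/
def clamp (a b x : ℝ) : ℝ := max a (min b x)

theorem clamp_mem {a b : ℝ} (hab : a ≤ b) (x : ℝ) : clamp a b x ∈ Icc a b :=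
  ⟨le_max_left _ _, max_le hab (min_le_left _ _)⟩

theorem clamp_of_mem {a b x : ℝ} (hx : x ∈ Icc a b) : clamp a b x = x := by
  rw [clamp, min_eq_right hx.2, max_eq_right hx.1]

theorem continuous_clamp (a b : ℝ) : Continuous (clamp a b) := by
  unfold clamp; fun_prop

/-- Replaces data known only on a closed rectangle by globally continuous functions, so that
differentiation and Fubini need no boundary cases. -/
theorem continuous_comp_clamp {k : ℝ → ℝ → ℝ} {a b c d : ℝ} (hab : a ≤ b) (hcd : c ≤ d)
    (hk : ContinuousOn (Function.uncurry k) (Icc a b ×ˢ Icc c d)) :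
    Continuous (Function.uncurry fun x y => k (clamp a b x) (clamp c d y)) :=
  hk.comp_continuous (f := fun z : ℝ × ℝ => (clamp a b z.1, clamp c d z.2))
    (((continuous_clamp a b).comp continuous_fst).prodMk ((continuous_clamp c d).comp continuous_snd))
    fun z => ⟨clamp_mem hab z.1, clamp_mem hcd z.2⟩

theorem integral_eq_sub_of_hasDerivWithinAt_Icc {a b x : ℝ} {u u' k : ℝ → ℝ}
    (hu : ∀ y ∈ Icc a b, HasDerivWithinAt u (u' y) (Icc a b) y) (hk : Continuous k)
    (huk : ∀ y ∈ Icc a b, u' y = k y) (hx : x ∈ Icc a b) :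
    ∫ y in a..x, k y = u x - u a := by
  have hsub : Icc a x ⊆ Icc a b := Icc_subset_Icc_right hx.2
  refine intervalIntegral.integral_eq_sub_of_hasDerivAt_of_le hx.1
    (fun y hy => (hu y (hsub hy)).continuousWithinAt.mono hsub) (fun y hy => ?_)
    (hk.intervalIntegrable _ _)
  have hy' := hsub ⟨hy.1.le, hy.2.le⟩
  rw [← huk y hy']
  exact (hu y hy').hasDerivAt (Icc_mem_nhds hy.1 (hy.2.trans_le hx.2))

theorem intervalIntegral_swap_of_continuous {k : ℝ → ℝ → ℝ} (hk : Continuous (Function.uncurry k))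
    (a b c d : ℝ) :
    ∫ x in a..b, ∫ y in c..d, k x y = ∫ y in c..d, ∫ x in a..b, k x y := by
  refine intervalIntegral_intervalIntegral_swap ?_
  exact (hk.continuousOn.integrableOn_compact (isCompact_uIcc.prod isCompact_uIcc)).mono_set
    (prod_mono uIoc_subset_uIcc uIoc_subset_uIcc)

namespace InsuranceModel

variable (M : InsuranceModel)

theorem Icc_subset_B {M : InsuranceModel} {R : ℝ} (hR : R ∈ M.B) : Icc 0 R ⊆ M.B := fun _ hb =>
  ⟨hb.1, lt_of_le_of_lt (EReal.coe_le_coe_iff.2 hb.2) hR.2⟩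

theorem lo_mem : M.θlo ∈ Icc M.θlo M.θhi := left_mem_Icc.2 M.θlo_lt_θhi.le

variable {M} {R : ℝ}

/-- Only the cross partial is assumed jointly continuous. Integrating it in `b` from the edge `b =
0`, where continuity in the type is assumed, transfers this to `Hθ`. -/
theorem Hθ_continuousOn (hR : R ∈ M.B) :
    ContinuousOn (Function.uncurry M.Hθ) (Icc M.θlo M.θhi ×ˢ Icc 0 R) := by
  have hB := Icc_subset_B hR
  have hk := continuous_comp_clamp M.θlo_lt_θhi.le hR.1
    (M.Hbθ_cont.mono (prod_mono_right hB))
  have h0 : (0 : ℝ) ∈ Icc 0 R := ⟨le_rfl, hR.1⟩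
  have hc0 := M.Hθ_cont 0 (hB h0).1 (hB h0).2
  have key : ∀ z ∈ Icc M.θlo M.θhi ×ˢ Icc 0 R, Function.uncurry M.Hθ z =
      M.Hθ z.1 0 + ∫ s in (0 : ℝ)..z.2, M.Hbθ (clamp M.θlo M.θhi z.1) (clamp 0 R s) := by
    rintro ⟨t, b⟩ ⟨ht, hb⟩
    have := integral_eq_sub_of_hasDerivWithinAt_Icc (u := M.Hθ t) (u' := M.Hbθ t)
      (k := fun s => M.Hbθ (clamp M.θlo M.θhi t) (clamp 0 R s))
      (fun y hy => (M.Hbθ_deriv t ht y (hB hy).1 (hB hy).2).mono hB)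
      (hk.comp (Continuous.prodMk_right t)) (fun y hy => by rw [clamp_of_mem ht, clamp_of_mem hy]) hb
    simp only [Function.uncurry]
    rw [this]; ring
  refine ContinuousOn.congr ?_ key
  refine ContinuousOn.add (hc0.comp continuousOn_fst fun z hz => hz.1) (Continuous.continuousOn ?_)
  refine intervalIntegral.continuous_parametric_intervalIntegral_of_continuous
    (f := fun z : ℝ × ℝ => fun s => M.Hbθ (clamp M.θlo M.θhi z.1) (clamp 0 R s)) ?_ continuous_snd
  exact hk.comp (f := fun z : (ℝ × ℝ) × ℝ => (z.1.1, z.2)) (by fun_prop)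

theorem H_eq_integral (hR : R ∈ M.B) {t b : ℝ} (ht : t ∈ Icc M.θlo M.θhi) (hb : b ∈ Icc 0 R) :
    ∫ s in M.θlo..t, M.Hθ (clamp M.θlo M.θhi s) (clamp 0 R b) = M.H t b - M.H M.θlo b := by
  have hB := Icc_subset_B hR
  have hk := continuous_comp_clamp M.θlo_lt_θhi.le hR.1 (Hθ_continuousOn hR)
  exact integral_eq_sub_of_hasDerivWithinAt_Icc (u := fun s => M.H s b) (u' := fun s => M.Hθ s b)
    (fun y hy => M.Hθ_deriv y hy b (hB hb).1 (hB hb).2)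
    (hk.comp (Continuous.prodMk_left b)) (fun y hy => by rw [clamp_of_mem hy, clamp_of_mem hb]) ht

theorem H_continuousOn_snd (hR : R ∈ M.B) {t : ℝ} (ht : t ∈ Icc M.θlo M.θhi) :
    ContinuousOn (M.H t) (Icc 0 R) := fun b hb =>
  have hB := Icc_subset_B hR
  (M.h_deriv t ht b (hB hb).1 (hB hb).2).continuousWithinAt.mono hB

theorem H_continuousOn (hR : R ∈ M.B) :
    ContinuousOn (Function.uncurry M.H) (Icc M.θlo M.θhi ×ˢ Icc 0 R) := by
  have hk := continuous_comp_clamp M.θlo_lt_θhi.le hR.1 (Hθ_continuousOn hR)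
  have key : ∀ z ∈ Icc M.θlo M.θhi ×ˢ Icc 0 R, Function.uncurry M.H z =
      M.H M.θlo z.2 + ∫ s in M.θlo..z.1, M.Hθ (clamp M.θlo M.θhi s) (clamp 0 R z.2) := by
    rintro ⟨t, b⟩ ⟨ht, hb⟩
    simp only [Function.uncurry]
    rw [H_eq_integral hR ht hb]; ring
  refine ContinuousOn.congr ?_ key
  refine ContinuousOn.add ((H_continuousOn_snd hR M.lo_mem).comp continuousOn_snd
    fun z hz => hz.2) (Continuous.continuousOn ?_)
  refine intervalIntegral.continuous_parametric_intervalIntegral_of_continuous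
    (f := fun z : ℝ × ℝ => fun s => M.Hθ (clamp M.θlo M.θhi s) (clamp 0 R z.2)) ?_ continuous_fst
  exact hk.comp (f := fun z : (ℝ × ℝ) × ℝ => (z.2, z.1.2)) (by fun_prop)

/-- `H` is a double integral of the cross partial plus edge terms. After the order of integration is
exchanged, `b` is an upper limit, and differentiating in `b` gives the formula by uniqueness of
derivatives. Joint continuity of `h` follows from it. -/
theorem h_eq_integral (hR : R ∈ M.B) (hR0 : 0 < R) {t b : ℝ} (ht : t ∈ Icc M.θlo M.θhi)
    (hb : b ∈ Icc 0 R) :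
    M.h t b = M.h M.θlo b + ∫ s in M.θlo..t, M.Hbθ (clamp M.θlo M.θhi s) (clamp 0 R b) := by
  have hB := Icc_subset_B hR
  have hk := continuous_comp_clamp M.θlo_lt_θhi.le hR.1
    (M.Hbθ_cont.mono (prod_mono_right hB))
  have hkθ := continuous_comp_clamp M.θlo_lt_θhi.le hR.1 (Hθ_continuousOn hR)
  have h0 : (0 : ℝ) ∈ Icc 0 R := ⟨le_rfl, hR.1⟩
  have hswap : ∀ y ∈ Icc 0 R, M.H t y = M.H M.θlo y + (M.H t 0 - M.H M.θlo 0) +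
      ∫ v in (0 : ℝ)..y, ∫ s in M.θlo..t, M.Hbθ (clamp M.θlo M.θhi s) (clamp 0 R v) := by
    intro y hy
    rw [← intervalIntegral_swap_of_continuous (k := fun s v =>
      M.Hbθ (clamp M.θlo M.θhi s) (clamp 0 R v)) hk]
    have e : ∀ s, ∫ v in (0 : ℝ)..y, M.Hbθ (clamp M.θlo M.θhi s) (clamp 0 R v) =
        M.Hθ (clamp M.θlo M.θhi s) (clamp 0 R y) - M.Hθ (clamp M.θlo M.θhi s) (clamp 0 R 0) := by
      intro s
      have hs := clamp_mem M.θlo_lt_θhi.le s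
      rw [clamp_of_mem hy, clamp_of_mem h0]
      exact integral_eq_sub_of_hasDerivWithinAt_Icc (u := M.Hθ (clamp M.θlo M.θhi s))
        (u' := M.Hbθ (clamp M.θlo M.θhi s))
        (fun y hy => (M.Hbθ_deriv _ hs y (hB hy).1 (hB hy).2).mono hB)
        (hk.comp (Continuous.prodMk_right s)) (fun y hy => by rw [clamp_of_mem hy]) hy
    simp_rw [e]
    rw [intervalIntegral.integral_sub, H_eq_integral hR ht hy, H_eq_integral hR ht h0]
    · ring
    · exact (hkθ.comp (Continuous.prodMk_left y)).intervalIntegrable _ _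
    · exact (hkθ.comp (Continuous.prodMk_left 0)).intervalIntegrable _ _
  have d1 : HasDerivWithinAt (M.H t) (M.h t b) (Icc 0 R) b :=
    (M.h_deriv t ht b (hB hb).1 (hB hb).2).mono hB
  have hcont : Continuous fun v => ∫ s in M.θlo..t, M.Hbθ (clamp M.θlo M.θhi s) (clamp 0 R v) :=
    intervalIntegral.continuous_parametric_intervalIntegral_of_continuous'
      (f := fun v s => M.Hbθ (clamp M.θlo M.θhi s) (clamp 0 R v)) (hk.comp continuous_swap) _ _
  have d2 := (((M.h_deriv _ M.lo_mem b (hB hb).1 (hB hb).2).mono hB).add_const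
    (M.H t 0 - M.H M.θlo 0)).add
      (hcont.integral_hasStrictDerivAt 0 b).hasDerivAt.hasDerivWithinAt
  have d3 := d2.congr (f₁ := M.H t) (fun y hy => hswap y hy) (hswap b hb)
  exact (uniqueDiffOn_Icc hR0 b hb).eq_deriv _ d1 d3

theorem h_continuousOn (hR : R ∈ M.B) (hR0 : 0 < R) :
    ContinuousOn (Function.uncurry M.h) (Icc M.θlo M.θhi ×ˢ Icc 0 R) := by
  have hB := Icc_subset_B hR
  have hk := continuous_comp_clamp M.θlo_lt_θhi.le hR.1
    (M.Hbθ_cont.mono (prod_mono_right hB))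
  refine ContinuousOn.congr ?_ fun z hz => h_eq_integral hR hR0 hz.1 hz.2
  refine ContinuousOn.add (((M.h_cont _ M.lo_mem).mono hB).comp continuousOn_snd
    fun z hz => hz.2) (Continuous.continuousOn ?_)
  refine intervalIntegral.continuous_parametric_intervalIntegral_of_continuous
    (f := fun z : ℝ × ℝ => fun s => M.Hbθ (clamp M.θlo M.θhi s) (clamp 0 R z.2)) ?_ continuous_fst
  exact hk.comp (f := fun z : (ℝ × ℝ) × ℝ => (z.2, z.1.2)) (by fun_prop)

theorem F_continuousOn : ContinuousOn M.F (Icc M.θlo M.θhi) := by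
  have := intervalIntegral.continuousOn_primitive_interval (μ := volume) (f := M.f)
    (a := M.θlo) (b := M.θhi)
    (by rw [uIcc_of_le M.θlo_lt_θhi.le]; exact M.f_cont.integrableOn_Icc)
  rwa [uIcc_of_le M.θlo_lt_θhi.le] at this

theorem H_mem_Icc (hR : R ∈ M.B) {z : ℝ × ℝ} (hz : z ∈ Icc M.θlo M.θhi ×ˢ Icc 0 R) :
    M.H z.1 z.2 ∈ Icc (0 : ℝ) 1 :=
  M.H_mem z.1 hz.1 z.2 (Icc_subset_B hR hz.2).1 (Icc_subset_B hR hz.2).2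

theorem J1_continuousOn (hR : R ∈ M.B) :
    ContinuousOn (Function.uncurry M.J1) (Icc M.θlo M.θhi ×ˢ Icc 0 R) := by
  have hH := H_continuousOn hR
  have hg : ContinuousOn M.g (Icc 0 1) := fun q hq => (M.g_deriv q hq).continuousWithinAt
  have e : Function.uncurry M.J1 = fun z : ℝ × ℝ => 1 - M.g (M.H z.1 z.2) +
    (1 - M.F z.1) / M.f z.1 * M.g' (M.H z.1 z.2) * M.Hθ z.1 z.2 := rfl
  rw [e]
  refine ContinuousOn.add (continuousOn_const.sub (hg.comp hH fun z hz => H_mem_Icc hR hz)) ?_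
  refine ContinuousOn.mul (ContinuousOn.mul ?_ (M.g'_cont.comp hH fun z hz => H_mem_Icc hR hz))
    (Hθ_continuousOn hR)
  have hfst : MapsTo (Prod.fst : ℝ × ℝ → ℝ) (Icc M.θlo M.θhi ×ˢ Icc 0 R) (Icc M.θlo M.θhi) :=
    fun z hz => hz.1
  exact (continuousOn_const.sub (F_continuousOn.comp continuousOn_fst hfst)).div
    (M.f_cont.comp continuousOn_fst hfst) fun z hz => (M.f_pos z.1 hz.1).ne'

theorem J_continuousOn (hR : R ∈ M.B) (hR0 : 0 < R) :
    ContinuousOn (Function.uncurry (M.J 0)) (Icc M.θlo M.θhi ×ˢ Icc 0 R) := by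
  have hB := Icc_subset_B hR
  have hne : ∀ z ∈ Icc M.θlo M.θhi ×ˢ Icc 0 R, M.h z.1 z.2 ≠ 0 := fun z hz =>
    (M.h_pos z.1 hz.1 z.2 (hB hz.2).1 (hB hz.2).2).ne'
  have e : Function.uncurry (M.J 0) = fun z : ℝ × ℝ => M.J1 z.1 z.2 / M.h z.1 z.2 +
    (z.2 - 0 - (1 - M.H z.1 z.2) / M.h z.1 z.2) := rfl
  rw [e]
  exact ((J1_continuousOn hR).div (h_continuousOn hR hR0) hne).add
    ((continuousOn_snd.sub continuousOn_const).sub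
      ((continuousOn_const.sub (H_continuousOn hR)).div (h_continuousOn hR hR0) hne))

end InsuranceModel

/-! ### Integration over the rectangle of types and valuations -/

/-- Lebesgue measure on the rectangle `(a, b] × (0, R]`. -/
def rectMeasure (a b R : ℝ) : Measure (ℝ × ℝ) :=
  (volume.restrict (Ioc a b)).prod (volume.restrict (Ioc 0 R))

instance (a b R : ℝ) : IsFiniteMeasure (rectMeasure a b R) := by
  unfold rectMeasure; infer_instance

theorem rectMeasure_eq (a b R : ℝ) :
    rectMeasure a b R = volume.restrict (Ioc a b ×ˢ Ioc 0 R) := by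
  rw [rectMeasure, Measure.prod_restrict, Measure.volume_eq_prod]

theorem ae_rectMeasure_mem (a b R : ℝ) :
    ∀ᵐ z ∂rectMeasure a b R, z.1 ∈ Ioc a b ∧ z.2 ∈ Ioc 0 R := by
  rw [rectMeasure_eq]
  filter_upwards [ae_restrict_mem (measurableSet_Ioc.prod measurableSet_Ioc)] with z hz using hz

theorem Continuous.integrable_rectMeasure {a b R : ℝ} {φ : ℝ × ℝ → ℝ} (hφ : Continuous φ) :
    Integrable φ (rectMeasure a b R) := by
  rw [rectMeasure_eq]
  exact (hφ.continuousOn.integrableOn_compact (isCompact_Icc.prod isCompact_Icc)).mono_set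
    (prod_mono Ioc_subset_Icc_self Ioc_subset_Icc_self)

theorem integrable_mul_rectMeasure {a b R : ℝ} {φ y : ℝ × ℝ → ℝ} (hφ : Continuous φ)
    (hy : Measurable y) (hy1 : ∀ᵐ z ∂rectMeasure a b R, y z ∈ Icc (0 : ℝ) 1) :
    Integrable (fun z => y z * φ z) (rectMeasure a b R) := by
  refine Integrable.bdd_mul (c := 1) hφ.integrable_rectMeasure hy.aestronglyMeasurable ?_
  filter_upwards [hy1] with z hz
  rw [Real.norm_eq_abs, abs_of_nonneg hz.1]
  exact hz.2

theorem integrable_ite_rectMeasure {a b R : ℝ} {φ : ℝ × ℝ → ℝ} {P : ℝ × ℝ → Prop}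
    [DecidablePred P] (hφ : Integrable φ (rectMeasure a b R)) (hP : MeasurableSet {z | P z}) :
    Integrable (fun z => if P z then φ z else 0) (rectMeasure a b R) := by
  have := hφ.indicator hP
  refine this.congr (ae_of_all _ fun z => ?_)
  by_cases h : P z <;> simp [indicator, h]

theorem measurableSet_snd_le (p : ℝ) : MeasurableSet {z : ℝ × ℝ | z.2 ≤ p} :=
  measurableSet_le measurable_snd measurable_const

/-- Moves the price from the domain into the integrand, so that one fixed finite measure serves all
prices. -/
theorem integral_integral_eq_rectMeasure {a b R p : ℝ} (hab : a ≤ b) {φ : ℝ × ℝ → ℝ}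
    (hφ : Integrable φ (rectMeasure a b R)) (hp : p ∈ Icc 0 R) :
    ∫ θ in a..b, ∫ s in (0 : ℝ)..p, φ (θ, s) =
      ∫ z, (if z.2 ≤ p then φ z else 0) ∂rectMeasure a b R := by
  have hi := integrable_ite_rectMeasure (P := fun z => z.2 ≤ p) hφ (measurableSet_snd_le p)
  rw [rectMeasure] at hi ⊢
  rw [integral_prod _ hi, intervalIntegral.integral_of_le hab]
  refine integral_congr_ae (ae_of_all _ fun θ => ?_)
  simp only
  rw [intervalIntegral.integral_of_le hp.1]
  have hI : Ioc 0 p = Iic p ∩ Ioc 0 R := by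
    ext s; simp only [mem_Ioc, mem_inter_iff, mem_Iic]
    exact ⟨fun h => ⟨h.2, h.1, h.2.trans hp.2⟩, fun h => ⟨h.2.1, h.1⟩⟩
  rw [hI, ← Measure.restrict_restrict measurableSet_Iic, ← integral_indicator measurableSet_Iic]
  refine integral_congr_ae (ae_of_all _ fun s => ?_)
  by_cases h : s ≤ p <;> simp [indicator, h]

theorem ae_rectMeasure_snd_ne (a b R p : ℝ) : ∀ᵐ z ∂rectMeasure a b R, z.2 ≠ p := by
  have hm : MeasurableSet {z : ℝ × ℝ | z.2 = p} := measurableSet_eq_fun measurable_snd measurable_const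
  rw [ae_iff]
  simp only [ne_eq, not_not]
  rw [rectMeasure, Measure.measure_prod_null hm]
  refine ae_of_all _ fun θ => ?_
  have : Prod.mk θ ⁻¹' {z : ℝ × ℝ | z.2 = p} = {p} := by ext; simp
  simp [this]

/-- The closed rectangle is the closure of its interior, so an open set meeting it contains a
nonempty open piece of the interior, which has positive measure. -/
theorem exists_mem_of_ae_rectMeasure {a b R p : ℝ} (hab : a < b) (hp0 : 0 < p) (hpR : p ≤ R)
    {U : Set (ℝ × ℝ)} (hU : IsOpen U) {z : ℝ × ℝ} (hz : z ∈ Icc a b ×ˢ Icc 0 p) (hzU : z ∈ U)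
    {P : ℝ × ℝ → Prop} (hP : ∀ᵐ z ∂rectMeasure a b R, P z) :
    ∃ z ∈ U, z.2 ≤ p ∧ P z := by
  by_contra! hcon
  have hV : IsOpen (U ∩ Ioo a b ×ˢ Ioo 0 p) := hU.inter (isOpen_Ioo.prod isOpen_Ioo)
  have hne : (U ∩ Ioo a b ×ˢ Ioo 0 p).Nonempty := by
    have : z ∈ closure (Ioo a b ×ˢ Ioo 0 p) := by
      rw [closure_prod_eq, closure_Ioo hab.ne, closure_Ioo hp0.ne]; exact hz
    exact mem_closure_iff.1 this U hU hzU
  have hpos := hV.measure_pos volume hne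
  rw [rectMeasure_eq, ae_restrict_iff' (measurableSet_Ioc.prod measurableSet_Ioc)] at hP
  refine hpos.ne' (measure_mono_null (fun y hy => ?_) (ae_iff.1 hP))
  intro h
  exact hcon y hy.1 hy.2.2.2.le
    (h ⟨Ioo_subset_Ioc_self hy.2.1, Ioo_subset_Ioc_self.trans (Ioc_subset_Ioc_right hpR) hy.2.2⟩)

/-! ### Mass served above a level, and the market-clearing level -/

section ServedMass

variable {a b R : ℝ} {j w : ℝ → ℝ → ℝ}

/-- Mass, with density `w`, of the pairs `(θ, s)` with `s ≤ p` and `j θ s > c`. -/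
def servedMass (a b R : ℝ) (j w : ℝ → ℝ → ℝ) (p c : ℝ) : ℝ :=
  ∫ z, (if z.2 ≤ p ∧ c < j z.1 z.2 then w z.1 z.2 else 0) ∂rectMeasure a b R

/-- By strict monotonicity each `θ`-slice of a level set has at most one point, so level sets are
null by Fubini. -/
theorem ae_rectMeasure_ne (hj : Continuous (Function.uncurry j))
    (hmono : ∀ θ, StrictMonoOn (j θ) (Icc 0 R)) (c : ℝ) :
    ∀ᵐ z ∂rectMeasure a b R, j z.1 z.2 ≠ c := by
  have hm : MeasurableSet {z : ℝ × ℝ | j z.1 z.2 = c} := hj.measurable (measurableSet_singleton c)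
  rw [ae_iff]
  simp only [ne_eq, not_not]
  rw [rectMeasure, Measure.measure_prod_null hm]
  refine ae_of_all _ fun θ => ?_
  have hm' : MeasurableSet (Prod.mk θ ⁻¹' {z : ℝ × ℝ | j z.1 z.2 = c}) := measurable_prodMk_left hm
  simp only [Measure.restrict_apply hm', Pi.zero_apply]
  refine Set.Subsingleton.measure_zero (fun s hs t ht => ?_) _
  exact (hmono θ).injOn (Ioc_subset_Icc_self hs.2) (Ioc_subset_Icc_self ht.2)
    ((show j θ s = c from hs.1).trans (show j θ t = c from ht.1).symm)

theorem measurableSet_served (hj : Continuous (Function.uncurry j)) (p c : ℝ) :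
    MeasurableSet {z : ℝ × ℝ | z.2 ≤ p ∧ c < j z.1 z.2} :=
  (measurableSet_snd_le p).inter (measurableSet_lt measurable_const hj.measurable)

theorem integrable_served (hj : Continuous (Function.uncurry j))
    (hw : Continuous (Function.uncurry w)) (p c : ℝ) :
    Integrable (fun z : ℝ × ℝ => if z.2 ≤ p ∧ c < j z.1 z.2 then w z.1 z.2 else 0)
      (rectMeasure a b R) :=
  integrable_ite_rectMeasure (P := fun z => z.2 ≤ p ∧ c < j z.1 z.2)
    (φ := fun z => w z.1 z.2) hw.integrable_rectMeasure (measurableSet_served hj p c)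

/-- Dominated convergence: off the null sets `s = p` and `j = c` the integrand is locally constant
in the pair of price and level. -/
theorem continuous_servedMass (hj : Continuous (Function.uncurry j))
    (hw : Continuous (Function.uncurry w)) (hmono : ∀ θ, StrictMonoOn (j θ) (Icc 0 R)) :
    Continuous fun x : ℝ × ℝ => servedMass a b R j w x.1 x.2 := by
  refine continuous_iff_continuousAt.2 fun x₀ => ?_
  refine continuousAt_of_dominated (bound := fun z => ‖w z.1 z.2‖)
    (Filter.Eventually.of_forall fun x => (integrable_served hj hw x.1 x.2).aestronglyMeasurable)
    (Filter.Eventually.of_forall fun x => ae_of_all _ fun z => ?_)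
    (hw.integrable_rectMeasure (φ := Function.uncurry w)).norm ?_
  · split_ifs <;> simp
  · filter_upwards [ae_rectMeasure_ne hj hmono x₀.2, ae_rectMeasure_snd_ne a b R x₀.1] with z h1 h2
    have hev : (fun x : ℝ × ℝ => if z.2 ≤ x.1 ∧ x.2 < j z.1 z.2 then w z.1 z.2 else 0) =ᶠ[nhds x₀]
        fun _ => if z.2 ≤ x₀.1 ∧ x₀.2 < j z.1 z.2 then w z.1 z.2 else 0 := by
      have e1 : ∀ᶠ x : ℝ × ℝ in nhds x₀, (z.2 ≤ x.1 ↔ z.2 ≤ x₀.1) := by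
        rcases lt_or_gt_of_ne h2 with h | h
        · filter_upwards [continuous_fst.tendsto x₀ (Ioi_mem_nhds h)] with x hx
          exact iff_of_true (le_of_lt hx) h.le
        · filter_upwards [continuous_fst.tendsto x₀ (Iio_mem_nhds h)] with x hx
          exact iff_of_false (not_le.2 hx) (not_le.2 h)
      have e2 : ∀ᶠ x : ℝ × ℝ in nhds x₀, (x.2 < j z.1 z.2 ↔ x₀.2 < j z.1 z.2) := by
        rcases lt_or_gt_of_ne h1 with h | h
        · filter_upwards [continuous_snd.tendsto x₀ (Ioi_mem_nhds h)] with x hx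
          exact iff_of_false (not_lt.2 (le_of_lt hx)) (not_lt.2 h.le)
        · filter_upwards [continuous_snd.tendsto x₀ (Iio_mem_nhds h)] with x hx
          exact iff_of_true hx h
      filter_upwards [e1, e2] with x hx1 hx2
      simp only [hx1, hx2]
    exact ContinuousAt.congr continuousAt_const hev.symm

theorem servedMass_nonneg (hw0 : ∀ θ s, 0 < w θ s) (p c : ℝ) :
    0 ≤ servedMass a b R j w p c :=
  integral_nonneg fun z => by
    have := (hw0 z.1 z.2).le
    simp only [Pi.zero_apply]
    split_ifs <;> first | exact this | exact le_rfl

theorem servedMass_antitone (hj : Continuous (Function.uncurry j))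
    (hw : Continuous (Function.uncurry w)) (hw0 : ∀ θ s, 0 < w θ s) (p : ℝ) :
    Antitone (servedMass a b R j w p) := by
  intro c d hcd
  refine integral_mono (integrable_served hj hw p d) (integrable_served hj hw p c) fun z => ?_
  have := (hw0 z.1 z.2).le
  simp only
  split_ifs with h1 h2 <;> first | exact le_rfl | exact this | skip
  exact absurd ⟨h1.1, hcd.trans_lt h1.2⟩ h2

/-- A value strictly between `c` and `d` would be taken near an open piece of the rectangle with
values in the same gap. That piece has positive mass and is counted at `c` but not at `d`. -/
theorem not_between_of_servedMass_eq (hab : a < b) (hj : Continuous (Function.uncurry j))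
    (hw : Continuous (Function.uncurry w)) (hw0 : ∀ θ s, 0 < w θ s) {p c d : ℝ} (hp0 : 0 < p)
    (hpR : p ≤ R) (hcd : c ≤ d) (h : servedMass a b R j w p c = servedMass a b R j w p d)
    {θ s : ℝ} (hθ : θ ∈ Icc a b) (hs : s ∈ Icc 0 p) (hc : c < j θ s) : d ≤ j θ s := by
  by_contra! hd
  have hle : (fun z : ℝ × ℝ => if z.2 ≤ p ∧ d < j z.1 z.2 then w z.1 z.2 else 0) ≤
      fun z => if z.2 ≤ p ∧ c < j z.1 z.2 then w z.1 z.2 else 0 := by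
    intro z
    have := (hw0 z.1 z.2).le
    simp only
    split_ifs with h1 h2 <;> first | exact le_rfl | exact this | skip
    exact absurd ⟨h1.1, hcd.trans_lt h1.2⟩ h2
  have hae := (integral_eq_iff_of_ae_le (integrable_served hj hw p d)
    (integrable_served hj hw p c) (ae_of_all (rectMeasure a b R) hle)).1 h.symm
  have hU : IsOpen {z : ℝ × ℝ | c < j z.1 z.2 ∧ j z.1 z.2 < d} :=
    (isOpen_lt continuous_const hj).inter (isOpen_lt hj continuous_const)
  obtain ⟨z, hzU, hzp, hz⟩ := exists_mem_of_ae_rectMeasure hab hp0 hpR hU (z := (θ, s)) ⟨hθ, hs⟩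
    ⟨hc, hd⟩ hae
  have h1 : ¬ (d < j z.1 z.2) := not_lt.2 hzU.2.le
  simp only [hzp, h1, hzU.1, and_false, and_self, if_true, if_false] at hz
  exact (hw0 z.1 z.2).ne hz

theorem isPreconnected_image_rect (hj : Continuous (Function.uncurry j)) (p : ℝ) :
    IsPreconnected (Function.uncurry j '' (Icc a b ×ˢ Icc 0 p)) :=
  (isPreconnected_Icc.prod isPreconnected_Icc).image _ hj.continuousOn

/-- The range of `j` is an interval, so between two of its levels there is a value that `j` attains.
The restriction to the range is essential: outside it the served mass is constant. -/
theorem servedMass_injOn (hab : a < b) (hj : Continuous (Function.uncurry j))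
    (hw : Continuous (Function.uncurry w)) (hw0 : ∀ θ s, 0 < w θ s) {p : ℝ} (hp0 : 0 < p)
    (hpR : p ≤ R) :
    InjOn (servedMass a b R j w p) (Function.uncurry j '' (Icc a b ×ˢ Icc 0 p)) := by
  have key : ∀ c ∈ Function.uncurry j '' (Icc a b ×ˢ Icc 0 p),
      ∀ d ∈ Function.uncurry j '' (Icc a b ×ˢ Icc 0 p),
      servedMass a b R j w p c = servedMass a b R j w p d → ¬ c < d := by
    intro c hc d hd h hlt
    obtain ⟨e, hce, hed⟩ := exists_between hlt
    obtain ⟨z, hz, rfl⟩ := (isPreconnected_image_rect hj p).ordConnected.out hc hd ⟨hce.le, hed.le⟩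
    exact absurd (not_between_of_servedMass_eq hab hj hw hw0 hp0 hpR hlt.le h hz.1 hz.2 hce)
      (not_le.2 hed)
  intro c hc d hd h
  exact le_antisymm (not_lt.1 (key d hd c hc h.symm)) (not_lt.1 (key c hc d hd h))

theorem servedMass_of_forall_le {p c : ℝ}
    (h : ∀ θ ∈ Icc a b, ∀ s ∈ Icc 0 p, j θ s ≤ c) : servedMass a b R j w p c = 0 := by
  refine integral_eq_zero_of_ae ?_
  filter_upwards [ae_rectMeasure_mem a b R] with z hz
  refine if_neg fun hh => ?_
  exact absurd hh.2 (not_lt.2 (h _ (Ioc_subset_Icc_self hz.1) _ ⟨hz.2.1.le, hh.1⟩))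

theorem servedMass_of_forall_ge (hj : Continuous (Function.uncurry j))
    (hmono : ∀ θ, StrictMonoOn (j θ) (Icc 0 R)) {p c : ℝ}
    (h : ∀ θ ∈ Icc a b, ∀ s ∈ Icc 0 p, c ≤ j θ s) :
    servedMass a b R j w p c = ∫ z, (if z.2 ≤ p then w z.1 z.2 else 0) ∂rectMeasure a b R := by
  refine integral_congr_ae ?_
  filter_upwards [ae_rectMeasure_mem a b R, ae_rectMeasure_ne hj hmono c] with z hz hne
  by_cases hp : z.2 ≤ p
  · have := lt_of_le_of_ne (h _ (Ioc_subset_Icc_self hz.1) _ ⟨hz.2.1.le, hp⟩) hne.symm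
    simp [hp, this]
  · simp [hp]

/-- Intermediate value theorem: the served mass runs from everything at the minimum of `j` to zero
at its maximum. -/
theorem exists_servedMass_eq (hab : a < b) (hj : Continuous (Function.uncurry j))
    (hw : Continuous (Function.uncurry w)) (hmono : ∀ θ, StrictMonoOn (j θ) (Icc 0 R)) {p r : ℝ}
    (hp0 : 0 < p) (hr0 : 0 ≤ r)
    (hr : r ≤ ∫ z, (if z.2 ≤ p then w z.1 z.2 else 0) ∂rectMeasure a b R) :
    ∃ c ∈ Function.uncurry j '' (Icc a b ×ˢ Icc 0 p), servedMass a b R j w p c = r := by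
  have hK : IsCompact (Icc a b ×ˢ Icc 0 p) := isCompact_Icc.prod isCompact_Icc
  have hne : (Icc a b ×ˢ Icc 0 p).Nonempty :=
    ⟨(a, 0), left_mem_Icc.2 hab.le, left_mem_Icc.2 hp0.le⟩
  obtain ⟨z₀, hz₀, hmin⟩ := hK.exists_isMinOn hne hj.continuousOn
  obtain ⟨z₁, hz₁, hmax⟩ := hK.exists_isMaxOn hne hj.continuousOn
  have hcont : Continuous (servedMass a b R j w p) :=
    (continuous_servedMass hj hw hmono).comp (Continuous.prodMk_right p)
  refine (((isPreconnected_image_rect hj p).image _ hcont.continuousOn).ordConnected.out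
    (mem_image_of_mem _ (mem_image_of_mem _ hz₁)) (mem_image_of_mem _ (mem_image_of_mem _ hz₀))
    (show r ∈ Icc _ _ from ⟨?_, ?_⟩))
  · rw [servedMass_of_forall_le (j := j) fun θ hθ s hs => isMaxOn_iff.1 hmax (θ, s) ⟨hθ, hs⟩]; exact hr0
  · rw [servedMass_of_forall_ge (j := j) hj hmono fun θ hθ s hs => isMinOn_iff.1 hmin (θ, s) ⟨hθ, hs⟩]; exact hr

/-- Closed graph plus compactness: the preimage of a closed set under `c` is the projection of a
compact set of triples (price, type, valuation) whose level clears. Injectivity on the range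
identifies that level with `c p`. -/
theorem continuousOn_clearing (hab : a < b) (hj : Continuous (Function.uncurry j))
    (hw : Continuous (Function.uncurry w)) (hmono : ∀ θ, StrictMonoOn (j θ) (Icc 0 R))
    (hw0 : ∀ θ s, 0 < w θ s) {l : ℝ} (hl : 0 < l) {r c : ℝ → ℝ}
    (hr : ContinuousOn r (Icc l R))
    (hc : ∀ p ∈ Icc l R, c p ∈ Function.uncurry j '' (Icc a b ×ˢ Icc 0 p) ∧
      servedMass a b R j w p (c p) = r p) :
    ContinuousOn c (Icc l R) := by
  have hK : IsCompact (Icc l R ×ˢ (Icc a b ×ˢ Icc 0 R)) :=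
    isCompact_Icc.prod (isCompact_Icc.prod isCompact_Icc)
  refine continuousOn_iff_isClosed.2 fun t ht => ?_
  have hclosed : IsClosed {x ∈ Icc l R ×ˢ (Icc a b ×ˢ Icc 0 R) |
      servedMass a b R j w x.1 (j x.2.1 x.2.2) = r x.1} := by
    refine IsClosed.isClosed_eq hK.isClosed (Continuous.continuousOn ?_)
      (hr.comp continuousOn_fst fun x hx => hx.1)
    exact (continuous_servedMass hj hw hmono).comp
      (f := fun x : ℝ × ℝ × ℝ => (x.1, j x.2.1 x.2.2))
      (continuous_fst.prodMk (hj.comp continuous_snd))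
  have hT : IsCompact ({x ∈ Icc l R ×ˢ (Icc a b ×ˢ Icc 0 R) |
      servedMass a b R j w x.1 (j x.2.1 x.2.2) = r x.1} ∩
      ({x | x.2.2 ≤ x.1} ∩ {x | j x.2.1 x.2.2 ∈ t})) := by
    refine (hK.of_isClosed_subset hclosed (sep_subset _ _)).inter_right (IsClosed.inter ?_ ?_)
    · exact isClosed_le (by fun_prop) (by fun_prop)
    · exact ht.preimage (hj.comp continuous_snd)
  refine ⟨_, (hT.image continuous_fst).isClosed, ?_⟩
  ext p
  constructor
  · rintro ⟨hpt, hp⟩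
    obtain ⟨⟨z, hz, hzc⟩, hcp⟩ := hc p hp
    refine ⟨⟨(p, z), ⟨⟨⟨hp, hz.1, hz.2.1, hz.2.2.trans hp.2⟩, ?_⟩, hz.2.2, ?_⟩, rfl⟩, hp⟩
    · have : j z.1 z.2 = c p := hzc
      simp only [this, hcp]
    · have : j z.1 z.2 = c p := hzc
      simp only [mem_ofPred_eq, this]; exact hpt
  · rintro ⟨⟨x, ⟨⟨hx, hxr⟩, hxp, hxt⟩, rfl⟩, hp⟩
    refine ⟨?_, hp⟩
    obtain ⟨hcK, hcp⟩ := hc x.1 hp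
    have := servedMass_injOn hab hj hw hw0 (hl.trans_le hp.1) hp.2 hcK
      ⟨x.2, ⟨hx.2.1, hx.2.2.1, hxp⟩, rfl⟩ (hcp.trans hxr.symm)
    rw [mem_preimage, this]; exact hxt

/-- Length of the set of `s ∈ (0, p]` at which `j θ s` does not exceed `c`: for increasing `j θ`
the point of `[0, p]` where `j θ` crosses `c`. -/
def crossing (j : ℝ → ℝ → ℝ) (p c θ : ℝ) : ℝ := volume.real (Ioc 0 p ∩ {s | j θ s ≤ c})

/-- Measurability is immediate because the crossing point is defined as the measure of a slice. -/
theorem measurable_crossing (hj : Continuous (Function.uncurry j)) (p c : ℝ) :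
    Measurable (crossing j p c) := by
  have hm : MeasurableSet {z : ℝ × ℝ | z.2 ∈ Ioc 0 p ∧ j z.1 z.2 ≤ c} :=
    (measurable_snd measurableSet_Ioc).inter (measurableSet_le hj.measurable measurable_const)
  exact (measurable_measure_prodMk_left (ν := volume) hm).ennreal_toReal

theorem crossing_mem {p : ℝ} (hp : 0 ≤ p) (c θ : ℝ) : crossing j p c θ ∈ Icc 0 p := by
  refine ⟨measureReal_nonneg, ?_⟩
  have := measureReal_mono (μ := volume) (inter_subset_left : Ioc 0 p ∩ {s | j θ s ≤ c} ⊆ Ioc 0 p)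
    measure_Ioc_lt_top.ne
  rwa [Real.volume_real_Ioc_of_le hp, sub_zero] at this

theorem crossing_lt_iff (hj : Continuous (Function.uncurry j))
    (hmono : ∀ θ, StrictMonoOn (j θ) (Icc 0 R)) {p c θ s : ℝ} (hpR : p ≤ R) (hs : s ∈ Ioc 0 p) :
    crossing j p c θ < s ↔ c < j θ s := by
  have hs' : s ∈ Icc 0 R := ⟨hs.1.le, hs.2.trans hpR⟩
  constructor
  · intro h
    by_contra! hc
    refine absurd h (not_lt.2 ?_)
    have hsub : Ioc 0 s ⊆ Ioc 0 p ∩ {s | j θ s ≤ c} := fun t ht =>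
      ⟨⟨ht.1, ht.2.trans hs.2⟩,
        ((hmono θ).monotoneOn ⟨ht.1.le, ht.2.trans hs'.2⟩ hs' ht.2).trans hc⟩
    have := measureReal_mono (μ := volume) hsub
      ((measure_mono inter_subset_left).trans_lt measure_Ioc_lt_top).ne
    rwa [Real.volume_real_Ioc_of_le hs.1.le, sub_zero] at this
  · intro h
    have hcont : Continuous (j θ) := hj.comp (Continuous.prodMk_right θ)
    -- Strictness needs slack: by continuity `j θ` already exceeds `c` at some `t < s`, so the
    -- sublevel set lies in `Ioc 0 t`.
    have hev : ∀ᶠ t in nhds s, c < j θ t := hcont.tendsto s (Ioi_mem_nhds h)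
    obtain ⟨t, ht, htc⟩ := ((hev.filter_mono nhdsWithin_le_nhds).and
      (Ioo_mem_nhdsLT hs.1)).exists
    have hsub : Ioc 0 p ∩ {s | j θ s ≤ c} ⊆ Ioc 0 t := fun u hu => by
      refine ⟨hu.1.1, ?_⟩
      by_contra! htu
      exact absurd (hu.2 : j θ u ≤ c) (not_le.2 (ht.trans_le
        ((hmono θ).monotoneOn ⟨htc.1.le, htc.2.le.trans hs'.2⟩ ⟨hu.1.1.le, hu.1.2.trans hpR⟩ htu.le)))
    have := measureReal_mono (μ := volume) hsub measure_Ioc_lt_top.ne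
    rw [Real.volume_real_Ioc_of_le htc.1.le, sub_zero] at this
    exact this.trans_lt htc.2

end ServedMass

/-! ### Envelope theorem -/

/-- Envelope theorem: if `V p = W p (c p)` is below `W p d` for every `d` among the selected
parameters, and the selection `c` is continuous, then `V` inherits the partial derivative of `W`. -/
theorem hasDerivWithinAt_of_envelope {l u : ℝ} {V c : ℝ → ℝ} {W P : ℝ → ℝ → ℝ}
    (hc : ContinuousOn c (Icc l u))
    (hW : ∀ d, ∀ p ∈ Icc l u, HasDerivWithinAt (fun q => W q d) (P p d) (Icc l u) p)
    (hP : ContinuousOn (Function.uncurry P) (Icc l u ×ˢ univ))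
    (hV : ∀ p ∈ Icc l u, V p = W p (c p)) (hle : ∀ p ∈ Icc l u, ∀ d, V p ≤ W p d)
    {p : ℝ} (hp : p ∈ Icc l u) : HasDerivWithinAt V (P p (c p)) (Icc l u) p := by
  rw [hasDerivWithinAt_iff_isLittleO, Asymptotics.isLittleO_iff]
  intro ε hε
  have hPat : ContinuousWithinAt (Function.uncurry P) (Icc l u ×ˢ univ) (p, c p) :=
    hP _ ⟨hp, mem_univ _⟩
  obtain ⟨δ, hδ, hPδ⟩ := Metric.continuousWithinAt_iff.1 hPat ε hε
  obtain ⟨δ', hδ', hcδ⟩ := Metric.continuousWithinAt_iff.1 (hc p hp) δ hδ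
  have hball : ∀ᶠ q in nhdsWithin p (Icc l u), q ∈ Icc l u ∧ dist q p < min δ δ' :=
    Filter.Eventually.and self_mem_nhdsWithin (nhdsWithin_le_nhds (Metric.ball_mem_nhds p (lt_min hδ hδ')))
  filter_upwards [hball] with q hq
  -- Mean value inequality in the price with the parameter `d` held fixed, uniform for `d` near `c
  -- p`.
  have hbound : ∀ d, dist d (c p) < δ →
      ‖(W q d - P p (c p) * q) - (W p d - P p (c p) * p)‖ ≤ ε * ‖q - p‖ := by
    intro d hd
    have hconv : Convex ℝ (Icc l u ∩ Metric.ball p (min δ δ')) :=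
      (convex_Icc l u).inter (convex_ball p _)
    refine hconv.norm_image_sub_le_of_norm_hasDerivWithin_le
      (f := fun x => W x d - P p (c p) * x) (f' := fun x => P x d - P p (c p)) (fun x hx => ?_)
      (fun x hx => ?_) ⟨hp, Metric.mem_ball_self (lt_min hδ hδ')⟩ ⟨hq.1, hq.2⟩
    · have := ((hW d x hx.1).mono inter_subset_left).sub
        (((hasDerivAt_id x).const_mul (P p (c p))).hasDerivWithinAt
          (s := Icc l u ∩ Metric.ball p (min δ δ')))
      rw [mul_one] at this
      exact this
    · have hx2 : dist x p < δ := lt_of_lt_of_le hx.2 (min_le_left _ _)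
      have := hPδ (x := (x, d)) ⟨hx.1, mem_univ _⟩ (by rw [Prod.dist_eq]; exact max_lt hx2 hd)
      rw [Real.dist_eq] at this
      exact this.le
  -- The choice `d = c p` bounds `V q - V p` from above, because `V q ≤ W q (c p)`; the choice `d =
  -- c q` bounds it from below, because `V p ≤ W p (c q)`.
  have h1 := abs_le.1 (hbound (c p) (by simpa using hδ))
  have h2 := abs_le.1 (hbound (c q) (hcδ hq.1 (hq.2.trans_le (min_le_right _ _))))
  rw [smul_eq_mul, Real.norm_eq_abs, abs_le]
  have e1 := hV p hp
  have e2 := hV q hq.1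
  have e3 := hle p hp (c q)
  have e4 := hle q hq.1 (c p)
  constructor <;> nlinarith

/-! ### The Lagrangian bound on profit and its attainment -/

namespace InsuranceModel

variable (M : InsuranceModel) (R : ℝ)

/-- Joint density of types and valuations, extended continuously from `Θ × [0, R]` to the plane. -/
def weight (θ b : ℝ) : ℝ :=
  M.h (clamp M.θlo M.θhi θ) (clamp 0 R b) * M.f (clamp M.θlo M.θhi θ)

/-- Virtual value at service price `0`, extended continuously from `Θ × [0, R]` to the plane. -/
def virt (θ b : ℝ) : ℝ := M.J 0 (clamp M.θlo M.θhi θ) (clamp 0 R b)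

/-- Largest total virtual value net of `c` from valuations in `[0, p]`. -/
def surplus (p c : ℝ) : ℝ :=
  ∫ z, (if z.2 ≤ p then max (M.virt R z.1 z.2 - c) 0 * M.weight R z.1 z.2 else 0)
    ∂rectMeasure M.θlo M.θhi R

variable {M R}

theorem clampΘ_mem (θ : ℝ) : clamp M.θlo M.θhi θ ∈ Icc M.θlo M.θhi := clamp_mem M.θlo_lt_θhi.le θ

theorem continuous_f_clamp : Continuous fun θ => M.f (clamp M.θlo M.θhi θ) :=
  M.f_cont.comp_continuous (continuous_clamp _ _) clampΘ_mem

theorem continuous_weight (hR : R ∈ M.B) (hR0 : 0 < R) :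
    Continuous (Function.uncurry (M.weight R)) :=
  (continuous_comp_clamp M.θlo_lt_θhi.le hR.1 (h_continuousOn hR hR0)).mul
    (continuous_f_clamp.comp continuous_fst)

theorem weight_pos (hR : R ∈ M.B) (θ b : ℝ) : 0 < M.weight R θ b :=
  have hb := Icc_subset_B hR (clamp_mem hR.1 b)
  mul_pos (M.h_pos _ (clampΘ_mem θ) _ hb.1 hb.2) (M.f_pos _ (clampΘ_mem θ))

theorem continuous_virt (hR : R ∈ M.B) (hR0 : 0 < R) :
    Continuous (Function.uncurry (M.virt R)) :=
  continuous_comp_clamp M.θlo_lt_θhi.le hR.1 (J_continuousOn hR hR0)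

theorem virt_strictMonoOn (hR : R ∈ M.B)
    (hJ : ∀ p : ℝ, ∀ θ ∈ M.Θ, StrictMonoOn (M.J p θ) M.B) (θ : ℝ) :
    StrictMonoOn (M.virt R θ) (Icc 0 R) := by
  intro s hs t ht hst
  simp only [virt, clamp_of_mem hs, clamp_of_mem ht]
  exact hJ 0 _ (clampΘ_mem θ) (Icc_subset_B hR hs) (Icc_subset_B hR ht) hst

theorem J_eq_virt {θ b : ℝ} (hθ : θ ∈ Icc M.θlo M.θhi) (hb : b ∈ Icc 0 R) (p : ℝ) :
    M.J p θ b = M.virt R θ b - p := by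
  simp only [virt, clamp_of_mem hθ, clamp_of_mem hb, J]; ring

theorem weight_eq {θ b : ℝ} (hθ : θ ∈ Icc M.θlo M.θhi) (hb : b ∈ Icc 0 R) :
    M.weight R θ b = M.h θ b * M.f θ := by
  simp only [weight, clamp_of_mem hθ, clamp_of_mem hb]

theorem intervalIntegral_congr_Icc {a b : ℝ} (hab : a ≤ b) {u v : ℝ → ℝ}
    (h : ∀ x ∈ Icc a b, u x = v x) : ∫ x in a..b, u x = ∫ x in a..b, v x :=
  intervalIntegral.integral_congr fun x hx => h x (by rwa [uIcc_of_le hab] at hx)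

theorem IsMonotoneAllocation.ae_mem {x : ℝ → ℝ → ℝ} (hx : M.IsMonotoneAllocation x)
    (hR : R ∈ M.B) :
    ∀ᵐ z ∂rectMeasure M.θlo M.θhi R, Function.uncurry x z ∈ Icc (0 : ℝ) 1 := by
  filter_upwards [ae_rectMeasure_mem M.θlo M.θhi R] with z hz
  exact (hx.2 z.1 (Ioc_subset_Icc_self hz.1)).1 z.2 (Icc_subset_B hR (Ioc_subset_Icc_self hz.2))

theorem IsMonotoneAllocation.integrable_mul {x : ℝ → ℝ → ℝ} (hx : M.IsMonotoneAllocation x)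
    (hR : R ∈ M.B) {k : ℝ → ℝ → ℝ} (hk : Continuous (Function.uncurry k)) :
    Integrable (fun z : ℝ × ℝ => x z.1 z.2 * k z.1 z.2) (rectMeasure M.θlo M.θhi R) :=
  integrable_mul_rectMeasure (φ := Function.uncurry k) hk hx.1 (hx.ae_mem hR)

theorem IsMonotoneAllocation.integrable_ite {x : ℝ → ℝ → ℝ} (hx : M.IsMonotoneAllocation x)
    (hR : R ∈ M.B) {k : ℝ → ℝ → ℝ} (hk : Continuous (Function.uncurry k)) (p : ℝ) :
    Integrable (fun z : ℝ × ℝ => if z.2 ≤ p then x z.1 z.2 * k z.1 z.2 else 0)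
      (rectMeasure M.θlo M.θhi R) :=
  integrable_ite_rectMeasure (P := fun z => z.2 ≤ p) (φ := fun z => x z.1 z.2 * k z.1 z.2)
    (hx.integrable_mul hR hk) (measurableSet_snd_le p)

theorem insuredDemand_eq (hR : R ∈ M.B) (hR0 : 0 < R) {x : ℝ → ℝ → ℝ}
    (hx : M.IsMonotoneAllocation x) {p : ℝ} (hp : p ∈ Icc 0 R) :
    M.insuredDemand x p = ∫ z, (if z.2 ≤ p then x z.1 z.2 * M.weight R z.1 z.2 else 0)
      ∂rectMeasure M.θlo M.θhi R := by
  rw [← integral_integral_eq_rectMeasure (φ := fun z => x z.1 z.2 * M.weight R z.1 z.2)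
    M.θlo_lt_θhi.le (hx.integrable_mul hR (continuous_weight hR hR0)) hp, insuredDemand]
  refine intervalIntegral_congr_Icc M.θlo_lt_θhi.le fun θ hθ => ?_
  rw [← intervalIntegral.integral_mul_const]
  refine intervalIntegral_congr_Icc hp.1 fun b hb => ?_
  simp only [weight_eq hθ (Icc_subset_Icc_right hp.2 hb), mul_assoc]

theorem K_eq_zero (hβ : M.β = 0) (p : ℝ) : M.K p = 0 := by
  simp [K, UNP, hβ]

theorem objective_eq (hβ : M.β = 0) (hR : R ∈ M.B) (hR0 : 0 < R) {x : ℝ → ℝ → ℝ}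
    (hx : M.IsMonotoneAllocation x) {p : ℝ} (hp : p ∈ Icc 0 R) :
    M.objective p x = ∫ z, (if z.2 ≤ p then
      x z.1 z.2 * ((M.virt R z.1 z.2 - p) * M.weight R z.1 z.2) else 0)
      ∂rectMeasure M.θlo M.θhi R := by
  rw [← integral_integral_eq_rectMeasure
    (φ := fun z => x z.1 z.2 * ((M.virt R z.1 z.2 - p) * M.weight R z.1 z.2))
    M.θlo_lt_θhi.le (hx.integrable_mul hR (k := fun θ b => (M.virt R θ b - p) * M.weight R θ b)
      (((continuous_virt hR hR0).sub continuous_const).mul (continuous_weight hR hR0))) hp,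
    objective, K_eq_zero hβ, add_zero]
  refine intervalIntegral_congr_Icc M.θlo_lt_θhi.le fun θ hθ => ?_
  rw [← intervalIntegral.integral_mul_const]
  refine intervalIntegral_congr_Icc hp.1 fun b hb => ?_
  have hb' := Icc_subset_Icc_right hp.2 hb
  simp only [weight_eq hθ hb', J_eq_virt hθ hb']
  ring

theorem continuous_excess (hR : R ∈ M.B) (hR0 : 0 < R) (c : ℝ) : Continuous
    (Function.uncurry fun θ b => max (M.virt R θ b - c) 0 * M.weight R θ b) :=
  (((continuous_virt hR hR0).sub continuous_const).max continuous_const).mul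
    (continuous_weight hR hR0)

theorem integrable_excess_ite (hR : R ∈ M.B) (hR0 : 0 < R) (p c : ℝ) :
    Integrable (fun z : ℝ × ℝ => if z.2 ≤ p then
      max (M.virt R z.1 z.2 - c) 0 * M.weight R z.1 z.2 else 0) (rectMeasure M.θlo M.θhi R) :=
  integrable_ite_rectMeasure (P := fun z => z.2 ≤ p)
    (φ := fun z => max (M.virt R z.1 z.2 - c) 0 * M.weight R z.1 z.2)
    (continuous_excess hR hR0 c).integrable_rectMeasure (measurableSet_snd_le p)

/-- The objective is the maximal surplus net of `c`, plus a term that depends on total demand only,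
less the loss from misallocation. -/
theorem objective_eq_surplus_sub (hβ : M.β = 0) (hR : R ∈ M.B) (hR0 : 0 < R) {x : ℝ → ℝ → ℝ}
    (hx : M.IsMonotoneAllocation x) {p : ℝ} (hp : p ∈ Icc 0 R) (c : ℝ) :
    M.objective p x = M.surplus R p c + (c - p) * M.insuredDemand x p -
      ∫ z, (if z.2 ≤ p then (max (M.virt R z.1 z.2 - c) 0 - x z.1 z.2 * (M.virt R z.1 z.2 - c)) *
        M.weight R z.1 z.2 else 0) ∂rectMeasure M.θlo M.θhi R := by
  have hv := continuous_virt hR hR0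
  have hw := continuous_weight hR hR0
  have i1 := hx.integrable_ite hR hw p
  have i2 := hx.integrable_ite hR (k := fun θ b => (M.virt R θ b - c) * M.weight R θ b)
    ((hv.sub continuous_const).mul hw) p
  have i3 := integrable_excess_ite hR hR0 p c
  have e : ∀ z : ℝ × ℝ, (if z.2 ≤ p then (max (M.virt R z.1 z.2 - c) 0 -
      x z.1 z.2 * (M.virt R z.1 z.2 - c)) * M.weight R z.1 z.2 else 0) =
      (if z.2 ≤ p then max (M.virt R z.1 z.2 - c) 0 * M.weight R z.1 z.2 else 0) -
      (if z.2 ≤ p then x z.1 z.2 * ((M.virt R z.1 z.2 - c) * M.weight R z.1 z.2) else 0) := by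
    intro z; split_ifs <;> ring
  have e' : ∀ z : ℝ × ℝ, (if z.2 ≤ p then
      x z.1 z.2 * ((M.virt R z.1 z.2 - p) * M.weight R z.1 z.2) else 0) =
      (if z.2 ≤ p then x z.1 z.2 * ((M.virt R z.1 z.2 - c) * M.weight R z.1 z.2) else 0) +
      (c - p) * (if z.2 ≤ p then x z.1 z.2 * M.weight R z.1 z.2 else 0) := by
    intro z; split_ifs <;> ring
  rw [objective_eq hβ hR hR0 hx hp, insuredDemand_eq hR hR0 hx hp, surplus]
  simp_rw [e, e']
  rw [integral_sub i3 i2, integral_add i2 (i1.const_mul _), integral_const_mul]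
  ring

/-- For `x` in `[0, 1]`, `x * t` never exceeds the positive part of `t`. -/
theorem misallocation_nonneg (hR : R ∈ M.B) {x : ℝ → ℝ → ℝ}
    (hx : M.IsMonotoneAllocation x) (p c : ℝ) :
    0 ≤ᵐ[rectMeasure M.θlo M.θhi R] fun z => if z.2 ≤ p then
      (max (M.virt R z.1 z.2 - c) 0 - x z.1 z.2 * (M.virt R z.1 z.2 - c)) *
        M.weight R z.1 z.2 else 0 := by
  filter_upwards [hx.ae_mem hR] with z hz
  simp only [Function.uncurry, mem_Icc] at hz
  simp only [Pi.zero_apply]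
  split_ifs
  · refine mul_nonneg ?_ (weight_pos hR _ _).le
    rcases le_total (M.virt R z.1 z.2 - c) 0 with h | h
    · rw [max_eq_right h]; nlinarith
    · rw [max_eq_left h]; nlinarith
  · exact le_rfl

theorem integrable_misallocation (hR : R ∈ M.B) (hR0 : 0 < R) {x : ℝ → ℝ → ℝ}
    (hx : M.IsMonotoneAllocation x) (p c : ℝ) :
    Integrable (fun z : ℝ × ℝ => if z.2 ≤ p then
      (max (M.virt R z.1 z.2 - c) 0 - x z.1 z.2 * (M.virt R z.1 z.2 - c)) *
        M.weight R z.1 z.2 else 0) (rectMeasure M.θlo M.θhi R) := by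
  have i2 := hx.integrable_ite hR (k := fun θ b => (M.virt R θ b - c) * M.weight R θ b)
    (((continuous_virt hR hR0).sub continuous_const).mul (continuous_weight hR hR0)) p
  refine ((integrable_excess_ite hR hR0 p c).sub i2).congr (ae_of_all _ fun z => ?_)
  simp only [Pi.sub_apply]
  split_ifs <;> ring

theorem objective_le (hβ : M.β = 0) (hR : R ∈ M.B) (hR0 : 0 < R) {x : ℝ → ℝ → ℝ}
    (hx : M.IsMonotoneAllocation x) {p : ℝ} (hp : p ∈ Icc 0 R) (c : ℝ) :
    M.objective p x ≤ M.surplus R p c + (c - p) * M.insuredDemand x p := by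
  rw [objective_eq_surplus_sub hβ hR hR0 hx hp c]
  linarith [integral_nonneg_of_ae (misallocation_nonneg hR hx p c)]

/-- Attaining the bound makes the integrated loss zero, hence its nonnegative integrand zero almost
everywhere. The weight is positive and the level set of `c` is null, which pins down `x`. -/
theorem ae_eq_of_objective_ge (hβ : M.β = 0) (hR : R ∈ M.B) (hR0 : 0 < R)
    (hJ : ∀ p : ℝ, ∀ θ ∈ M.Θ, StrictMonoOn (M.J p θ) M.B) {x : ℝ → ℝ → ℝ}
    (hx : M.IsMonotoneAllocation x) {p c : ℝ} (hp : p ∈ Icc 0 R)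
    (h : M.surplus R p c + (c - p) * M.insuredDemand x p ≤ M.objective p x) :
    ∀ᵐ z ∂rectMeasure M.θlo M.θhi R, z.2 ≤ p →
      x z.1 z.2 = if c < M.virt R z.1 z.2 then 1 else 0 := by
  have h0 := integral_nonneg_of_ae (misallocation_nonneg hR hx p c)
  rw [objective_eq_surplus_sub hβ hR hR0 hx hp c] at h
  have hz := (integral_eq_zero_iff_of_nonneg_ae (misallocation_nonneg hR hx p c)
    (integrable_misallocation hR hR0 hx p c)).1 (le_antisymm (by linarith) h0)
  filter_upwards [hz, ae_rectMeasure_ne (continuous_virt hR hR0) (virt_strictMonoOn hR hJ) c]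
    with z hz hne hzp
  simp only [hzp, if_true, Pi.zero_apply] at hz
  have h1 := (mul_eq_zero.1 hz).resolve_right (weight_pos hR _ _).ne'
  split_ifs with hc
  · rw [max_eq_left (by linarith)] at h1
    have : (M.virt R z.1 z.2 - c) * (1 - x z.1 z.2) = 0 := by linarith
    linarith [(mul_eq_zero.1 this).resolve_left (by linarith : (0 : ℝ) < _).ne']
  · rw [max_eq_right (by linarith)] at h1
    have : (M.virt R z.1 z.2 - c) * x z.1 z.2 = 0 := by linarith
    exact (mul_eq_zero.1 this).resolve_left (sub_ne_zero.2 hne)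

theorem insuredDemand_of_ae_eq (hR : R ∈ M.B) (hR0 : 0 < R) {x : ℝ → ℝ → ℝ}
    (hx : M.IsMonotoneAllocation x) {p c : ℝ} (hp : p ∈ Icc 0 R)
    (h : ∀ᵐ z ∂rectMeasure M.θlo M.θhi R, z.2 ≤ p →
      x z.1 z.2 = if c < M.virt R z.1 z.2 then 1 else 0) :
    M.insuredDemand x p = servedMass M.θlo M.θhi R (M.virt R) (M.weight R) p c := by
  rw [insuredDemand_eq hR hR0 hx hp]
  refine integral_congr_ae ?_
  filter_upwards [h] with z hz
  by_cases hzp : z.2 ≤ p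
  · by_cases hc : c < M.virt R z.1 z.2 <;> simp [hzp, hz hzp, hc]
  · simp [hzp]

theorem objective_of_ae_eq (hβ : M.β = 0) (hR : R ∈ M.B) (hR0 : 0 < R) {x : ℝ → ℝ → ℝ}
    (hx : M.IsMonotoneAllocation x) {p c : ℝ} (hp : p ∈ Icc 0 R)
    (h : ∀ᵐ z ∂rectMeasure M.θlo M.θhi R, z.2 ≤ p →
      x z.1 z.2 = if c < M.virt R z.1 z.2 then 1 else 0) :
    M.objective p x = M.surplus R p c + (c - p) * M.insuredDemand x p := by
  rw [objective_eq_surplus_sub hβ hR hR0 hx hp c, integral_eq_zero_of_ae, sub_zero]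
  filter_upwards [h] with z hz
  by_cases hzp : z.2 ≤ p
  · by_cases hc : c < M.virt R z.1 z.2
    · simp [hzp, hz hzp, hc, max_eq_left (sub_nonneg.2 hc.le)]
    · simp [hzp, hz hzp, hc, max_eq_right (sub_nonpos.2 (not_lt.1 hc))]
  · simp [hzp]

theorem isMonotoneAllocation_deductible {D : ℝ → ℝ} (hD : Measurable D) :
    M.IsMonotoneAllocation (deductibleAllocation D) := by
  refine ⟨Measurable.ite (measurableSet_lt (hD.comp measurable_fst) measurable_snd)
    measurable_const measurable_const, fun θ _ => ⟨fun b _ => ?_, fun b _ b' _ hb => ?_⟩⟩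
  · simp only [deductibleAllocation]; split_ifs <;> simp
  · simp only [deductibleAllocation]
    split_ifs with h1 h2 <;>
      first | exact le_rfl | exact absurd (h1.trans_le hb) h2 | exact zero_le_one

variable (M R) in
/-- The deductible profile that serves exactly the virtual values above `c`. -/
def cutoff (p c θ : ℝ) : ℝ := crossing (M.virt R) p c θ

theorem isMonotoneAllocation_cutoff (hR : R ∈ M.B) (hR0 : 0 < R) (p c : ℝ) :
    M.IsMonotoneAllocation (deductibleAllocation (M.cutoff R p c)) :=
  isMonotoneAllocation_deductible (measurable_crossing (continuous_virt hR hR0) p c)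

theorem ae_eq_cutoff (hR : R ∈ M.B) (hR0 : 0 < R)
    (hJ : ∀ p : ℝ, ∀ θ ∈ M.Θ, StrictMonoOn (M.J p θ) M.B) {p : ℝ} (hp : p ∈ Icc 0 R) (c : ℝ) :
    ∀ᵐ z ∂rectMeasure M.θlo M.θhi R, z.2 ≤ p →
      deductibleAllocation (M.cutoff R p c) z.1 z.2 =
        if c < M.virt R z.1 z.2 then 1 else 0 := by
  filter_upwards [ae_rectMeasure_mem M.θlo M.θhi R] with z hz hzp
  simp only [deductibleAllocation, cutoff,
    crossing_lt_iff (continuous_virt hR hR0) (virt_strictMonoOn hR hJ) hp.2 ⟨hz.2.1, hzp⟩]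

/-- When `c` clears the market the cutoff profile is feasible and attains the bound. (EQ) fixes
insured demand, so the bound is the same for every feasible competitor. -/
theorem isOptimalDeductible_cutoff (hβ : M.β = 0) (hR : R ∈ M.B) (hR0 : 0 < R)
    (hJ : ∀ p : ℝ, ∀ θ ∈ M.Θ, StrictMonoOn (M.J p θ) M.B) {p c : ℝ} (hp : p ∈ Icc 0 R)
    (h : servedMass M.θlo M.θhi R (M.virt R) (M.weight R) p c = M.RS p) :
    M.IsOptimalDeductible p (M.cutoff R p c) := by
  have hx := isMonotoneAllocation_cutoff hR hR0 p c
  have hae := ae_eq_cutoff hR hR0 hJ hp c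
  have hd := (insuredDemand_of_ae_eq hR hR0 hx hp hae).trans h
  refine ⟨fun θ _ => crossing_mem hp.1 c θ, ⟨hx, hd⟩, fun y hy => ?_⟩
  rw [objective_of_ae_eq hβ hR hR0 hx hp hae, hd, ← hy.2]
  exact objective_le hβ hR hR0 hy.1 hp c

theorem profit_eq (hβ : M.β = 0) (hR : R ∈ M.B) (hR0 : 0 < R)
    (hJ : ∀ p : ℝ, ∀ θ ∈ M.Θ, StrictMonoOn (M.J p θ) M.B) {p c : ℝ} (hp : p ∈ Icc 0 R)
    (h : servedMass M.θlo M.θhi R (M.virt R) (M.weight R) p c = M.RS p) :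
    M.profit p = M.surplus R p c + (c - p) * M.RS p := by
  have ho := (isOptimalDeductible_cutoff hβ hR hR0 hJ hp h).2
  have hobj := objective_of_ae_eq hβ hR hR0 ho.1.1 hp (ae_eq_cutoff hR hR0 hJ hp c)
  rw [ho.1.2] at hobj
  rw [← hobj]
  refine IsGreatest.csSup_eq ⟨mem_image_of_mem _ ho.1, ?_⟩
  rintro _ ⟨y, hy, rfl⟩
  exact ho.2 y hy

theorem profit_le (hβ : M.β = 0) (hR : R ∈ M.B) (hR0 : 0 < R)
    {p : ℝ} (hp : p ∈ Icc 0 R) (hne : ∃ x, M.IsFeasible p x) (c : ℝ) :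
    M.profit p ≤ M.surplus R p c + (c - p) * M.RS p := by
  obtain ⟨x, hx⟩ := hne
  refine csSup_le ⟨_, mem_image_of_mem _ hx⟩ ?_
  rintro _ ⟨y, hy, rfl⟩
  have := objective_le hβ hR hR0 hy.1 hp c
  rwa [hy.2] at this

/-- At `c = p` the demand term of the bound vanishes, so the bound governs the unconstrained
problem. Its solutions agree almost everywhere with the cutoff rule at `p`, and one of them clears
the market. -/
theorem IsPriceTakingBenchmark.servedMass_eq (hβ : M.β = 0) (hR : R ∈ M.B) (hR0 : 0 < R)
    (hJ : ∀ p : ℝ, ∀ θ ∈ M.Θ, StrictMonoOn (M.J p θ) M.B) {p : ℝ} (hp : p ∈ Icc 0 R)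
    (h : M.IsPriceTakingBenchmark p) :
    servedMass M.θlo M.θhi R (M.virt R) (M.weight R) p p = M.RS p := by
  obtain ⟨x, ⟨hx, hopt⟩, hd⟩ := h
  have hy := isMonotoneAllocation_cutoff hR hR0 p p
  have hle := hopt _ hy
  rw [objective_of_ae_eq hβ hR hR0 hy hp (ae_eq_cutoff hR hR0 hJ hp p)] at hle
  have hae := ae_eq_of_objective_ge (c := p) hβ hR hR0 hJ hx hp (by linarith)
  rw [← insuredDemand_of_ae_eq hR hR0 hx hp hae, RS, ← hd, demand]
  ring

theorem IsOptimalDeductible.ae_eq (hβ : M.β = 0) (hR : R ∈ M.B) (hR0 : 0 < R)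
    (hJ : ∀ p : ℝ, ∀ θ ∈ M.Θ, StrictMonoOn (M.J p θ) M.B) {p c : ℝ} (hp : p ∈ Icc 0 R)
    (h : servedMass M.θlo M.θhi R (M.virt R) (M.weight R) p c = M.RS p) {D : ℝ → ℝ}
    (hD : M.IsOptimalDeductible p D) :
    ∀ᵐ z ∂rectMeasure M.θlo M.θhi R, z.2 ≤ p →
      deductibleAllocation D z.1 z.2 = if c < M.virt R z.1 z.2 then 1 else 0 := by
  have ho := (isOptimalDeductible_cutoff hβ hR hR0 hJ hp h).2
  have hobj := objective_of_ae_eq hβ hR hR0 ho.1.1 hp (ae_eq_cutoff hR hR0 hJ hp c)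
  refine ae_eq_of_objective_ge hβ hR hR0 hJ hD.2.1.1 hp ?_
  rw [hD.2.1.2, ← ho.1.2, ← hobj]
  exact hD.2.2 _ ho.1

end InsuranceModel

/-! ### The price derivative of the bound and its monotonicity -/

namespace InsuranceModel

variable (M : InsuranceModel) (R : ℝ)

/-- Density at the valuation `b` of the mass of agents. -/
def massAt (b : ℝ) : ℝ := ∫ θ in M.θlo..M.θhi, M.weight R θ b

/-- Virtual value net of `c` at the valuation `b`, from the types for which it is positive. -/
def excessAt (b c : ℝ) : ℝ :=
  ∫ θ in M.θlo..M.θhi, max (M.virt R θ b - c) 0 * M.weight R θ b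

/-- Partial derivative in the price of the Lagrangian bound on profit. -/
def margin (p c : ℝ) : ℝ := M.excessAt R p c - M.RS p + (c - p) * (M.S' p + M.massAt R p)

variable {M R}

theorem continuous_massAt (hR : R ∈ M.B) (hR0 : 0 < R) : Continuous (M.massAt R) :=
  intervalIntegral.continuous_parametric_intervalIntegral_of_continuous'
    (f := fun b θ => M.weight R θ b) ((continuous_weight hR hR0).comp continuous_swap) _ _

theorem continuous_excessAt (hR : R ∈ M.B) (hR0 : 0 < R) :
    Continuous (Function.uncurry (M.excessAt R)) := by
  refine intervalIntegral.continuous_parametric_intervalIntegral_of_continuous'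
    (f := fun (x : ℝ × ℝ) θ => max (M.virt R θ x.1 - x.2) 0 * M.weight R θ x.1) ?_ _ _
  have e : Continuous fun x : (ℝ × ℝ) × ℝ => (x.2, x.1.1) := by fun_prop
  exact ((((continuous_virt hR hR0).comp e).sub (continuous_snd.comp continuous_fst)).max
    continuous_const).mul ((continuous_weight hR hR0).comp e)

/-- After Fubini the price is only an upper limit of integration, ready for the fundamental theorem
of calculus. -/
theorem surplus_eq (hR : R ∈ M.B) (hR0 : 0 < R) {p : ℝ} (hp : p ∈ Icc 0 R) (c : ℝ) :
    M.surplus R p c = ∫ b in (0 : ℝ)..p, M.excessAt R b c := by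
  have hc := continuous_excess hR hR0 c
  rw [surplus, ← integral_integral_eq_rectMeasure
    (φ := fun z => max (M.virt R z.1 z.2 - c) 0 * M.weight R z.1 z.2) M.θlo_lt_θhi.le
    hc.integrable_rectMeasure hp]
  exact intervalIntegral_swap_of_continuous
    (k := fun θ b => max (M.virt R θ b - c) 0 * M.weight R θ b) hc _ _ _ _

theorem integral_weight_rect (hR : R ∈ M.B) (hR0 : 0 < R) {p : ℝ} (hp : p ∈ Icc 0 R) :
    ∫ z, (if z.2 ≤ p then M.weight R z.1 z.2 else 0) ∂rectMeasure M.θlo M.θhi R =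
      ∫ b in (0 : ℝ)..p, M.massAt R b := by
  have hc := continuous_weight hR hR0
  rw [← integral_integral_eq_rectMeasure (φ := fun z => M.weight R z.1 z.2) M.θlo_lt_θhi.le
    hc.integrable_rectMeasure hp]
  exact intervalIntegral_swap_of_continuous (k := M.weight R) hc _ _ _ _

theorem integral_weight (hR : R ∈ M.B) (hR0 : 0 < R) {θ s t : ℝ} (hθ : θ ∈ Icc M.θlo M.θhi)
    (hs : s ∈ Icc 0 R) (ht : t ∈ Icc 0 R) :
    ∫ b in s..t, M.weight R θ b = (M.H θ t - M.H θ s) * M.f θ := by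
  have hB := Icc_subset_B hR
  have hc : Continuous (M.weight R θ) := (continuous_weight hR hR0).comp (Continuous.prodMk_right θ)
  have key : ∀ x ∈ Icc 0 R, ∫ b in (0 : ℝ)..x, M.weight R θ b =
      M.H θ x * M.f θ - M.H θ 0 * M.f θ := fun x hx =>
    integral_eq_sub_of_hasDerivWithinAt_Icc (u := fun b => M.H θ b * M.f θ)
      (u' := fun b => M.h θ b * M.f θ)
      (fun y hy => ((M.h_deriv θ hθ y (hB hy).1 (hB hy).2).mono hB).mul_const _) hc
      (fun y hy => (weight_eq hθ hy).symm) hx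
  rw [← intervalIntegral.integral_interval_sub_left (hc.intervalIntegrable 0 t)
    (hc.intervalIntegrable 0 s), key t ht, key s hs]
  ring

theorem H_continuousOn_fst (hR : R ∈ M.B) {p : ℝ} (hp : p ∈ Icc 0 R) :
    ContinuousOn (fun θ => M.H θ p) (Icc M.θlo M.θhi) :=
  (H_continuousOn hR).comp (f := fun θ => (θ, p)) (by fun_prop) fun _ hθ => ⟨hθ, hp⟩

theorem intervalIntegrable_of_continuousOn_Θ {u : ℝ → ℝ} (hu : ContinuousOn u (Icc M.θlo M.θhi)) :
    IntervalIntegrable u volume M.θlo M.θhi :=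
  ContinuousOn.intervalIntegrable (by rwa [uIcc_of_le M.θlo_lt_θhi.le])

theorem intervalIntegrable_base (hR : R ∈ M.B) {p : ℝ} (hp : p ∈ Icc 0 R) :
    IntervalIntegrable (fun θ => (1 - M.H θ p) * M.f θ) volume M.θlo M.θhi :=
  intervalIntegrable_of_continuousOn_Θ
    ((continuousOn_const.sub (H_continuousOn_fst hR hp)).mul M.f_cont)

theorem baseDemand_sub (hR : R ∈ M.B) (hR0 : 0 < R) {s t : ℝ} (hs : s ∈ Icc 0 R)
    (ht : t ∈ Icc 0 R) :
    M.baseDemand s - M.baseDemand t = ∫ b in s..t, M.massAt R b := by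
  have e : ∫ b in s..t, M.massAt R b = ∫ θ in M.θlo..M.θhi, ∫ b in s..t, M.weight R θ b :=
    (intervalIntegral_swap_of_continuous (continuous_weight hR hR0) _ _ _ _).symm
  rw [e, baseDemand, baseDemand, ← intervalIntegral.integral_sub (intervalIntegrable_base hR hs)
    (intervalIntegrable_base hR ht)]
  refine intervalIntegral_congr_Icc M.θlo_lt_θhi.le fun θ hθ => ?_
  rw [integral_weight hR hR0 hθ hs ht]; ring

theorem massAt_nonneg (hR : R ∈ M.B) (b : ℝ) : 0 ≤ M.massAt R b :=
  intervalIntegral.integral_nonneg M.θlo_lt_θhi.le fun θ _ => (weight_pos hR θ b).le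

theorem massAt_pos (hR : R ∈ M.B) (hR0 : 0 < R) (b : ℝ) : 0 < M.massAt R b :=
  intervalIntegral.intervalIntegral_pos_of_pos
    (((continuous_weight hR hR0).comp (Continuous.prodMk_left b)).intervalIntegrable _ _)
    (fun θ => weight_pos hR θ b) M.θlo_lt_θhi

theorem hasDerivWithinAt_RS (hR : R ∈ M.B) (hR0 : 0 < R) {p : ℝ} (hp : p ∈ Icc 0 R) :
    HasDerivWithinAt M.RS (M.S' p + M.massAt R p) (Icc 0 R) p := by
  have h0 : (0 : ℝ) ∈ Icc 0 R := ⟨le_rfl, hR.1⟩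
  have d := (((M.S_deriv p hp.1).mono Icc_subset_Ici_self).sub_const (M.baseDemand 0)).add
    (((continuous_massAt hR hR0).integral_hasStrictDerivAt 0 p).hasDerivAt.hasDerivWithinAt
      (s := Icc 0 R))
  refine d.congr (fun q hq => ?_) ?_
  · simp only [RS, Pi.add_apply]; linarith [baseDemand_sub hR hR0 h0 hq]
  · simp only [RS, Pi.add_apply]; linarith [baseDemand_sub hR hR0 h0 hp]

theorem hasDerivWithinAt_bound (hR : R ∈ M.B) (hR0 : 0 < R) {p : ℝ} (hp : p ∈ Icc 0 R) (c : ℝ) :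
    HasDerivWithinAt (fun q => M.surplus R q c + (c - q) * M.RS q) (M.margin R p c)
      (Icc 0 R) p := by
  have hc : Continuous fun b => M.excessAt R b c :=
    (continuous_excessAt hR hR0).comp (f := fun b => (b, c)) (by fun_prop)
  have d1 := (hc.integral_hasStrictDerivAt 0 p).hasDerivAt.hasDerivWithinAt (s := Icc 0 R)
  have d2 := (((hasDerivAt_id p).const_sub c).hasDerivWithinAt (s := Icc 0 R)).mul
    (hasDerivWithinAt_RS hR hR0 hp)
  refine ((d1.add d2).congr (fun q hq => ?_) ?_).congr_deriv ?_
  · simp [surplus_eq hR hR0 hq]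
  · simp [surplus_eq hR hR0 hp]
  · simp only [margin, id]; ring

theorem continuousOn_RS (hR : R ∈ M.B) (hR0 : 0 < R) : ContinuousOn M.RS (Icc 0 R) :=
  fun _ hp => (hasDerivWithinAt_RS hR hR0 hp).continuousWithinAt

theorem continuousOn_margin (hR : R ∈ M.B) (hR0 : 0 < R) :
    ContinuousOn (Function.uncurry (M.margin R)) (Icc 0 R ×ˢ univ) := by
  have hfst : MapsTo (Prod.fst : ℝ × ℝ → ℝ) (Icc 0 R ×ˢ univ) (Icc 0 R) := fun z hz => hz.1
  have e : Function.uncurry (M.margin R) = fun z : ℝ × ℝ =>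
    Function.uncurry (M.excessAt R) z - M.RS z.1 + (z.2 - z.1) * (M.S' z.1 + M.massAt R z.1) := rfl
  rw [e]
  exact ((continuous_excessAt hR hR0).continuousOn.sub
    ((continuousOn_RS hR hR0).comp continuousOn_fst hfst)).add
    ((continuousOn_snd.sub continuousOn_fst).mul
      (((M.S'_cont.mono Icc_subset_Ici_self).comp continuousOn_fst hfst).add
        ((continuous_massAt hR hR0).comp continuous_fst).continuousOn))

theorem S'_nonneg {p : ℝ} (hp : 0 ≤ p) : 0 ≤ M.S' p := by
  rw [← (M.S_deriv p hp).derivWithin (uniqueDiffOn_Ici 0 p hp)]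
  exact M.S_strictMono.monotoneOn.derivWithin_nonneg

/-- The positive part is 1-Lipschitz. -/
theorem excessAt_sub_le (hR : R ∈ M.B) (hR0 : 0 < R) {p c d : ℝ} (hcd : c ≤ d) :
    M.excessAt R p c - M.excessAt R p d ≤ (d - c) * M.massAt R p := by
  have i : ∀ c, IntervalIntegrable (fun θ => max (M.virt R θ p - c) 0 * M.weight R θ p)
      volume M.θlo M.θhi := fun c =>
    ((continuous_excess hR hR0 c).comp (Continuous.prodMk_left p)).intervalIntegrable _ _
  have iw : IntervalIntegrable (fun θ => M.weight R θ p) volume M.θlo M.θhi :=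
    ((continuous_weight hR hR0).comp (Continuous.prodMk_left p)).intervalIntegrable _ _
  rw [excessAt, excessAt, massAt, ← intervalIntegral.integral_sub (i c) (i d),
    ← intervalIntegral.integral_const_mul]
  refine intervalIntegral.integral_mono_on M.θlo_lt_θhi.le ((i c).sub (i d)) (iw.const_mul _)
    fun θ _ => ?_
  rw [← sub_mul]
  refine mul_le_mul_of_nonneg_right ?_ (weight_pos hR θ p).le
  have : max (M.virt R θ p - c) 0 ≤ max (M.virt R θ p - d) 0 + (d - c) :=
    max_le (by linarith [le_max_left (M.virt R θ p - d) 0])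
      (by linarith [le_max_right (M.virt R θ p - d) 0])
  linarith

/-- Raising `c` lowers the excess at a rate of at most `massAt`, while the last term of the margin
grows at rate `S' + massAt` with `S' ≥ 0`. -/
theorem margin_self_le (hR : R ∈ M.B) (hR0 : 0 < R) {p c : ℝ} (hp : 0 ≤ p) (hpc : p ≤ c) :
    M.margin R p p ≤ M.margin R p c := by
  have h1 := excessAt_sub_le hR hR0 (p := p) hpc
  have h2 := mul_nonneg (sub_nonneg.2 hpc) (M.S'_nonneg hp)
  simp only [margin]; nlinarith

theorem margin_le_self (hR : R ∈ M.B) (hR0 : 0 < R) {p c : ℝ} (hp : 0 ≤ p) (hpc : c ≤ p) :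
    M.margin R p c ≤ M.margin R p p := by
  have h1 := excessAt_sub_le hR hR0 (p := p) hpc
  have h2 := mul_nonneg (sub_nonneg.2 hpc) (M.S'_nonneg hp)
  simp only [margin]; nlinarith

theorem virt_sub_mul (hR : R ∈ M.B) {θ p : ℝ} (hθ : θ ∈ Icc M.θlo M.θhi) (hp : p ∈ Icc 0 R) :
    (M.virt R θ p - p) * M.h θ p = M.J1 θ p - (1 - M.H θ p) := by
  have hb := Icc_subset_B hR hp
  have := (M.h_pos θ hθ p hb.1 hb.2).ne'
  simp only [virt, clamp_of_mem hθ, clamp_of_mem hp, J]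
  field_simp
  ring

theorem lt_virt_iff (hR : R ∈ M.B) {θ p : ℝ} (hθ : θ ∈ Icc M.θlo M.θhi) (hp : p ∈ Icc 0 R) :
    p < M.virt R θ p ↔ 1 - M.H θ p < M.J1 θ p := by
  have hb := Icc_subset_B hR hp
  have hh := M.h_pos θ hθ p hb.1 hb.2
  rw [← sub_pos, ← mul_pos_iff_of_pos_right hh, virt_sub_mul hR hθ hp, sub_pos]

theorem intervalIntegrable_max (hR : R ∈ M.B) {p : ℝ} (hp : p ∈ Icc 0 R) :
    IntervalIntegrable (fun θ => max (M.J1 θ p) (1 - M.H θ p) * M.f θ) volume M.θlo M.θhi := by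
  refine intervalIntegrable_of_continuousOn_Θ (ContinuousOn.mul (ContinuousOn.sup ?_ ?_) M.f_cont)
  · exact (J1_continuousOn hR).comp (f := fun θ => (θ, p)) (by fun_prop) fun _ hθ => ⟨hθ, hp⟩
  · exact continuousOn_const.sub (H_continuousOn_fst hR hp)

/-- On the diagonal the term in `S'` drops out. Multiplying by `h` turns `virt - p` into `J1 - (1 -
H)`, and adding the base demand contained in `RS` turns its positive part into a maximum. -/
theorem margin_self_eq (hR : R ∈ M.B) (hR0 : 0 < R) {p : ℝ} (hp : p ∈ Icc 0 R) :
    M.margin R p p = (∫ θ in M.θlo..M.θhi, max (M.J1 θ p) (1 - M.H θ p) * M.f θ) - M.S p := by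
  have i : IntervalIntegrable (fun θ => max (M.virt R θ p - p) 0 * M.weight R θ p)
      volume M.θlo M.θhi :=
    ((continuous_excess hR hR0 p).comp (Continuous.prodMk_left p)).intervalIntegrable _ _
  have e : (∫ θ in M.θlo..M.θhi, max (M.J1 θ p) (1 - M.H θ p) * M.f θ) =
      M.excessAt R p p + M.baseDemand p := by
    rw [excessAt, baseDemand, ← intervalIntegral.integral_add i (intervalIntegrable_base hR hp)]
    refine intervalIntegral_congr_Icc M.θlo_lt_θhi.le fun θ hθ => ?_
    have hb := Icc_subset_B hR hp
    have hmax : max (M.J1 θ p) (1 - M.H θ p) =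
        max (M.J1 θ p - (1 - M.H θ p)) 0 + (1 - M.H θ p) := by
      rw [← max_add_add_right]; simp
    rw [weight_eq hθ hp, ← mul_assoc, max_mul_of_nonneg _ _ (M.h_pos θ hθ p hb.1 hb.2).le,
      virt_sub_mul hR hθ hp, zero_mul, ← add_mul, hmax]
  rw [e, margin, RS]; ring

/-- Both entries of the maximum are non-increasing in the price; strictness comes from supply alone.
-/
theorem margin_self_strictAntiOn (hR : R ∈ M.B) (hR0 : 0 < R)
    (hJ1 : ∀ θ ∈ M.Θ, AntitoneOn (M.J1 θ) M.B) :
    StrictAntiOn (fun p => M.margin R p p) (Icc 0 R) := by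
  intro p hp q hq hpq
  have hB := Icc_subset_B hR
  simp only
  rw [margin_self_eq hR hR0 hp, margin_self_eq hR hR0 hq]
  have hS := M.S_strictMono hp.1 hq.1 hpq
  have := intervalIntegral.integral_mono_on M.θlo_lt_θhi.le (intervalIntegrable_max hR hq)
    (intervalIntegrable_max hR hp) fun θ hθ => by
      refine mul_le_mul_of_nonneg_right (max_le_max (hJ1 θ hθ (hB hp) (hB hq) hpq.le) ?_)
        (M.f_pos θ hθ).le
      have h1 := integral_weight hR hR0 hθ hp hq
      have h2 := intervalIntegral.integral_nonneg (μ := volume) hpq.le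
        fun b _ => (weight_pos hR θ b).le
      rw [h1] at h2
      linarith [(mul_nonneg_iff_of_pos_right (M.f_pos θ hθ)).1 h2]
  linarith

end InsuranceModel

/-! ### Optimal deductibles, surplus extraction and cost effect -/

theorem exists_mem_Ioo_of_ae {R s t : ℝ} {P : ℝ → Prop}
    (h : ∀ᵐ b ∂volume.restrict (Ioc 0 R), P b) (hs : 0 ≤ s) (hst : s < t) (ht : t ≤ R) :
    ∃ b ∈ Ioo s t, P b := by
  by_contra! hcon
  rw [ae_restrict_iff' measurableSet_Ioc] at h
  refine ((isOpen_Ioo (a := s) (b := t)).measure_pos volume (nonempty_Ioo.2 hst)).ne'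
    (measure_mono_null (fun b hb => ?_) (ae_iff.1 h))
  exact fun hP => hcon b hb (hP ⟨hs.trans_lt hb.1, hb.2.le.trans ht⟩)

theorem integral_ite_lt_mul {p d : ℝ} (hd : d ∈ Icc 0 p) (k : ℝ → ℝ) :
    ∫ b in (0 : ℝ)..p, (if d < b then 1 else 0) * k b = ∫ b in d..p, k b := by
  rw [intervalIntegral.integral_of_le (hd.1.trans hd.2), intervalIntegral.integral_of_le hd.2]
  have hI : Ioc d p = Ioc 0 p ∩ Ioi d := by
    ext b; simp only [mem_Ioc, mem_inter_iff, mem_Ioi]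
    exact ⟨fun h => ⟨⟨hd.1.trans_lt h.1, h.2⟩, h.1⟩, fun h => ⟨h.2, h.1.2⟩⟩
  rw [hI, ← setIntegral_indicator measurableSet_Ioi]
  refine integral_congr_ae (ae_of_all _ fun b => ?_)
  by_cases h : d < b <;> simp [indicator, h]

namespace InsuranceModel

variable {M : InsuranceModel} {R : ℝ}

/-- Measurability is assumed only for the allocation, and each set `D < b` is a level set of one of
its slices. -/
theorem IsMonotoneAllocation.measurable_deductible {D : ℝ → ℝ}
    (h : M.IsMonotoneAllocation (deductibleAllocation D)) : Measurable D := by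
  refine measurable_of_Iio fun b => ?_
  have hm : Measurable fun θ => deductibleAllocation D θ b := h.1.comp measurable_prodMk_right
  have e : D ⁻¹' Iio b = (fun θ => deductibleAllocation D θ b) ⁻¹' {1} := by
    ext θ
    by_cases hb : D θ < b <;> simp [deductibleAllocation, hb]
  rw [e]
  exact hm (measurableSet_singleton 1)

theorem continuous_H_clamp (hR : R ∈ M.B) : Continuous (Function.uncurry fun θ b =>
    M.H (clamp M.θlo M.θhi θ) (clamp 0 R b)) :=
  continuous_comp_clamp M.θlo_lt_θhi.le hR.1 (H_continuousOn hR)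

theorem intervalIntegrable_H_comp (hR : R ∈ M.B) {D : ℝ → ℝ} (hD : Measurable D)
    (hDR : ∀ θ ∈ Icc M.θlo M.θhi, D θ ∈ Icc 0 R) :
    IntervalIntegrable (fun θ => (1 - M.H θ (D θ)) * M.f θ) volume M.θlo M.θhi := by
  have hm : Measurable fun θ => 1 - M.H (clamp M.θlo M.θhi θ) (clamp 0 R (D θ)) :=
    measurable_const.sub ((continuous_H_clamp hR).measurable.comp (measurable_id.prodMk hD))
  have hf : IntervalIntegrable (fun θ => M.f (clamp M.θlo M.θhi θ)) volume M.θlo M.θhi :=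
    continuous_f_clamp.intervalIntegrable _ _
  rw [intervalIntegrable_iff_integrableOn_Ioc_of_le M.θlo_lt_θhi.le] at hf ⊢
  refine Integrable.congr (hf.bdd_mul (c := 1) hm.aestronglyMeasurable
    (ae_of_all _ fun θ => ?_)) ?_
  · have := H_mem_Icc hR (z := (clamp M.θlo M.θhi θ, clamp 0 R (D θ)))
      ⟨clampΘ_mem θ, clamp_mem hR.1 _⟩
    rw [Real.norm_eq_abs, abs_le]
    exact ⟨by linarith [this.2], by linarith [this.1]⟩
  · filter_upwards [ae_restrict_mem measurableSet_Ioc] with θ hθ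
    have hθ' := Ioc_subset_Icc_self hθ
    simp only [clamp_of_mem hθ', clamp_of_mem (hDR θ hθ')]

theorem insuredDemand_deductible (hR : R ∈ M.B) (hR0 : 0 < R) {p : ℝ} (hp : p ∈ Icc 0 R)
    {D : ℝ → ℝ} (hD : ∀ θ ∈ Icc M.θlo M.θhi, D θ ∈ Icc 0 p) :
    M.insuredDemand (deductibleAllocation D) p =
      ∫ θ in M.θlo..M.θhi, (M.H θ p - M.H θ (D θ)) * M.f θ := by
  refine intervalIntegral_congr_Icc M.θlo_lt_θhi.le fun θ hθ => ?_
  simp only [deductibleAllocation]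
  rw [integral_ite_lt_mul (hD θ hθ),
    ← integral_weight hR hR0 hθ (Icc_subset_Icc_right hp.2 (hD θ hθ)) hp,
    ← intervalIntegral.integral_mul_const]
  refine intervalIntegral_congr_Icc (hD θ hθ).2 fun b hb => ?_
  rw [weight_eq hθ ⟨(hD θ hθ).1.trans hb.1, hb.2.trans hp.2⟩]

/-- In total the agents with valuation above their deductible seek the service: insured demand
covers `(D θ, p]` and base demand the rest. -/
theorem S_eq_of_feasible_deductible (hR : R ∈ M.B) (hR0 : 0 < R) {p : ℝ} (hp : p ∈ Icc 0 R)
    {D : ℝ → ℝ} (hD : ∀ θ ∈ Icc M.θlo M.θhi, D θ ∈ Icc 0 p)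
    (h : M.IsFeasible p (deductibleAllocation D)) :
    M.S p = ∫ θ in M.θlo..M.θhi, (1 - M.H θ (D θ)) * M.f θ := by
  have hi := intervalIntegrable_H_comp hR h.1.measurable_deductible
    fun θ hθ => Icc_subset_Icc_right hp.2 (hD θ hθ)
  have h2 := h.2
  rw [insuredDemand_deductible hR hR0 hp hD, RS, baseDemand] at h2
  have e : ∫ θ in M.θlo..M.θhi, (M.H θ p - M.H θ (D θ)) * M.f θ =
      (∫ θ in M.θlo..M.θhi, (1 - M.H θ (D θ)) * M.f θ) -
        ∫ θ in M.θlo..M.θhi, (1 - M.H θ p) * M.f θ := by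
    rw [← intervalIntegral.integral_sub hi (intervalIntegrable_base hR hp)]
    congr 1; ext θ; ring
  linarith

/-- The almost-everywhere description of the allocation says nothing on the null line `b = p`. It is
evaluated at valuations just below `p` and carried to `p` by monotonicity and continuity of the
virtual value. -/
theorem IsOptimalDeductible.ae_lt_iff (hβ : M.β = 0) (hR : R ∈ M.B) (hR0 : 0 < R)
    (hJ : ∀ p : ℝ, ∀ θ ∈ M.Θ, StrictMonoOn (M.J p θ) M.B) {p c : ℝ} (hp : p ∈ Icc 0 R)
    (hp0 : 0 < p)
    (h : servedMass M.θlo M.θhi R (M.virt R) (M.weight R) p c = M.RS p) {D : ℝ → ℝ}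
    (hD : M.IsOptimalDeductible p D) :
    ∀ᵐ θ ∂volume.restrict (Ioc M.θlo M.θhi), D θ < p ↔ c < M.virt R θ p := by
  have hae := hD.ae_eq hβ hR hR0 hJ hp h
  rw [rectMeasure] at hae
  filter_upwards [Measure.ae_ae_of_ae_prod hae, ae_restrict_mem measurableSet_Ioc] with θ hθ hmem
  have hDθ := hD.1 θ (Ioc_subset_Icc_self hmem)
  have hgood : ∀ b, (b ≤ p → deductibleAllocation D θ b = if c < M.virt R θ b then 1 else 0) →
      b ≤ p → (D θ < b ↔ c < M.virt R θ b) := by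
    intro b hb hbp
    have := hb hbp
    simp only [deductibleAllocation] at this
    constructor
    · intro h1; by_contra h2; simp [h1, h2] at this
    · intro h2; by_contra h1; simp [h1, h2] at this
  constructor
  · intro hlt
    obtain ⟨b, hb, hbP⟩ := exists_mem_Ioo_of_ae hθ hDθ.1 hlt hp.2
    refine ((hgood b hbP hb.2.le).1 hb.1).trans ?_
    exact virt_strictMonoOn hR hJ θ ⟨hDθ.1.trans hb.1.le, hb.2.le.trans hp.2⟩ hp hb.2
  · intro hlt
    have hcont : Continuous (M.virt R θ) :=
      (continuous_virt hR hR0).comp (Continuous.prodMk_right θ)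
    have hev : ∀ᶠ t in nhds p, c < M.virt R θ t := hcont.tendsto p (Ioi_mem_nhds hlt)
    obtain ⟨t, ht, htp⟩ := ((hev.filter_mono nhdsWithin_le_nhds).and
      (Ioo_mem_nhdsLT hp0)).exists
    obtain ⟨b, hb, hbP⟩ := exists_mem_Ioo_of_ae hθ htp.1.le htp.2 hp.2
    refine ((hgood b hbP hb.2.le).2 (ht.trans ?_)).trans hb.2
    exact virt_strictMonoOn hR hJ θ ⟨htp.1.le, htp.2.le.trans hp.2⟩
      ⟨htp.1.le.trans hb.1.le, hb.2.le.trans hp.2⟩ hb.1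

/-- At a price that clears the market with multiplier zero, the surplus extraction force net of the
cost effect is the margin. -/
theorem IsOptimalDeductible.surplusExtraction_sub_costEffect (hβ : M.β = 0) (hR : R ∈ M.B)
    (hR0 : 0 < R) (hJ : ∀ p : ℝ, ∀ θ ∈ M.Θ, StrictMonoOn (M.J p θ) M.B) {p : ℝ}
    (hp : p ∈ Icc 0 R) (hp0 : 0 < p)
    (h : servedMass M.θlo M.θhi R (M.virt R) (M.weight R) p p = M.RS p) {D : ℝ → ℝ}
    (hD : M.IsOptimalDeductible p D) :
    M.surplusExtraction p D - M.costEffect p D = M.margin R p p := by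
  have hDm := hD.2.1.1.measurable_deductible
  have hset : MeasurableSet {θ | D θ < p} := measurableSet_lt hDm measurable_const
  have hite : ∀ u : ℝ → ℝ, IntervalIntegrable (fun θ => u θ * M.f θ) volume M.θlo M.θhi →
      IntervalIntegrable (fun θ => (if D θ < p then u θ else 0) * M.f θ)
        volume M.θlo M.θhi := by
    intro u hu
    rw [intervalIntegrable_iff_integrableOn_Ioc_of_le M.θlo_lt_θhi.le] at hu ⊢
    refine Integrable.congr (hu.indicator hset) (ae_of_all _ fun θ => ?_)
    by_cases hθ : D θ < p <;> simp [indicator, hθ]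
  have iD := intervalIntegrable_H_comp hR hDm
    fun θ hθ => Icc_subset_Icc_right hp.2 (hD.1 θ hθ)
  have iJ : IntervalIntegrable (fun θ => M.J1 θ p * M.f θ) volume M.θlo M.θhi :=
    intervalIntegrable_of_continuousOn_Θ (((J1_continuousOn hR).comp (f := fun θ => (θ, p))
      (by fun_prop) fun _ hθ => ⟨hθ, hp⟩).mul M.f_cont)
  rw [margin_self_eq hR hR0 hp, S_eq_of_feasible_deductible hR hR0 hp hD.1 hD.2.1,
    surplusExtraction, costEffect, ← intervalIntegral.integral_sub (hite _ iJ) (hite _ iD),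
    ← intervalIntegral.integral_sub (intervalIntegrable_max hR hp) iD,
    intervalIntegral.integral_of_le M.θlo_lt_θhi.le, intervalIntegral.integral_of_le M.θlo_lt_θhi.le]
  refine integral_congr_ae ?_
  filter_upwards [hD.ae_lt_iff hβ hR hR0 hJ hp hp0 h, ae_restrict_mem measurableSet_Ioc]
    with θ hθ hmem
  have hθ' := Ioc_subset_Icc_self hmem
  rw [lt_virt_iff hR hθ' hp] at hθ
  -- Covered types have the maximum equal to `J1`. Uncovered types have `D θ = p`, so the maximum `1
  -- - H θ p` cancels their share of supply.
  by_cases hlt : D θ < p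
  · simp only [hlt, if_true, max_eq_left (hθ.1 hlt).le]
  · have hDp : D θ = p := le_antisymm (hD.1 θ hθ').2 (not_lt.1 hlt)
    simp only [max_eq_right (not_lt.1 fun h' => hlt (hθ.2 h')), hDp, lt_irrefl, if_false]
    ring

/-! ### The dual problem in quantities at the benchmark -/

section Dual

variable {p θ : ℝ}

theorem H_strictMonoOn (hR : R ∈ M.B) (hR0 : 0 < R) (hθ : θ ∈ Icc M.θlo M.θhi) :
    StrictMonoOn (M.H θ) (Icc 0 R) := by
  intro s hs t ht hst
  have hc : Continuous (M.weight R θ) := (continuous_weight hR hR0).comp (Continuous.prodMk_right θ)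
  have h := intervalIntegral.intervalIntegral_pos_of_pos (hc.intervalIntegrable s t)
    (fun b => weight_pos hR θ b) hst
  rw [integral_weight hR hR0 hθ hs ht] at h
  linarith [(mul_pos_iff_of_pos_right (M.f_pos θ hθ)).1 h]

theorem condH_strictMonoOn (hR : R ∈ M.B) (hθ : θ ∈ Icc M.θlo M.θhi) (hp : p ∈ Icc 0 R)
    (hp0 : 0 < p) : StrictMonoOn (M.condH p θ) (Icc 0 p) := by
  intro s hs t ht hst
  have hH := H_strictMonoOn hR (hp0.trans_le hp.2) hθ
  have h0 := hH ⟨le_rfl, hR.1⟩ hp hp0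
  have h1 := hH (Icc_subset_Icc_right hp.2 hs) (Icc_subset_Icc_right hp.2 ht) hst
  exact div_lt_div_of_pos_right (by linarith) (by linarith)

theorem bq_condH (hR : R ∈ M.B) (hθ : θ ∈ Icc M.θlo M.θhi) (hp : p ∈ Icc 0 R)
    (hp0 : 0 < p) {d : ℝ} (hd : d ∈ Icc 0 p) : M.bq p θ (1 - M.condH p θ d) = d := by
  have e : {b : ℝ | b ∈ Icc 0 p ∧ 1 - (1 - M.condH p θ d) ≤ M.condH p θ b} = Icc d p := by
    ext b
    simp only [mem_ofPred_eq, sub_sub_cancel]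
    constructor
    · rintro ⟨hb, h⟩
      exact ⟨((condH_strictMonoOn hR hθ hp hp0).le_iff_le hd hb).1 h, hb.2⟩
    · intro hb
      have hb' : b ∈ Icc 0 p := ⟨hd.1.trans hb.1, hb.2⟩
      exact ⟨hb', ((condH_strictMonoOn hR hθ hp hp0).le_iff_le hd hb').2 hb.1⟩
  rw [bq, e, csInf_Icc hd.2]

theorem condH_continuousOn (hR : R ∈ M.B) (hθ : θ ∈ Icc M.θlo M.θhi) (hp : p ∈ Icc 0 R) :
    ContinuousOn (M.condH p θ) (Icc 0 p) :=
  (((H_continuousOn_snd hR hθ).mono (Icc_subset_Icc_right hp.2)).sub continuousOn_const).div_const _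

theorem condH_self (hR : R ∈ M.B) (hθ : θ ∈ Icc M.θlo M.θhi) (hp : p ∈ Icc 0 R)
    (hp0 : 0 < p) : M.condH p θ p = 1 := by
  have := H_strictMonoOn hR (hp0.trans_le hp.2) hθ ⟨le_rfl, hR.1⟩ hp hp0
  exact div_self (by linarith)

theorem exists_condH_eq (hR : R ∈ M.B) (hθ : θ ∈ Icc M.θlo M.θhi) (hp : p ∈ Icc 0 R)
    (hp0 : 0 < p) {q : ℝ} (hq : q ∈ Icc (0 : ℝ) 1) : ∃ d ∈ Icc 0 p, 1 - M.condH p θ d = q := by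
  obtain ⟨d, hd, hdq⟩ := intermediate_value_Icc hp0.le (condH_continuousOn hR hθ hp)
    (show 1 - q ∈ Icc (M.condH p θ 0) (M.condH p θ p) by
      rw [condH_self hR hθ hp hp0]
      simp only [condH, sub_self, zero_div]
      exact ⟨by linarith [hq.2], by linarith [hq.1]⟩)
  exact ⟨d, hd, by rw [hdq]; ring⟩

theorem condH_mem (hR : R ∈ M.B) (hθ : θ ∈ Icc M.θlo M.θhi) (hp : p ∈ Icc 0 R)
    (hp0 : 0 < p) {d : ℝ} (hd : d ∈ Icc 0 p) : M.condH p θ d ∈ Icc (0 : ℝ) 1 := by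
  have hm := (condH_strictMonoOn hR hθ hp hp0).monotoneOn
  have h1 := hm (left_mem_Icc.2 hp0.le) hd hd.1
  have h2 := hm hd (right_mem_Icc.2 hp0.le) hd.2
  rw [condH_self hR hθ hp hp0] at h2
  simp only [condH, sub_self, zero_div] at h1
  exact ⟨h1, h2⟩

/-- Change of variables from quantities to valuations. -/
theorem Φ_condH (hR : R ∈ M.B) (hθ : θ ∈ Icc M.θlo M.θhi) (hp : p ∈ Icc 0 R)
    (hp0 : 0 < p) {d : ℝ} (hd : d ∈ Icc 0 p) :
    M.Φ p θ (1 - M.condH p θ d) = ∫ b in d..p, M.J p θ b * M.h θ b := by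
  have hB := Icc_subset_B hR
  have hsub : Icc d p ⊆ Icc 0 p := Icc_subset_Icc_left hd.1
  have hH0 := H_strictMonoOn hR (hp0.trans_le hp.2) hθ ⟨le_rfl, hR.1⟩ hp hp0
  have hanti : AntitoneOn (fun b => 1 - M.condH p θ b) (Icc d p) := fun s hs t ht hst =>
    sub_le_sub_left ((condH_strictMonoOn hR hθ hp hp0).monotoneOn (hsub hs) (hsub ht) hst) 1
  have hcont : ContinuousOn (fun b => 1 - M.condH p θ b) (Icc d p) :=
    continuousOn_const.sub ((condH_continuousOn hR hθ hp).mono hsub)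
  have himg : (fun b => 1 - M.condH p θ b) '' Icc d p = Icc 0 (1 - M.condH p θ d) := by
    have e : (0 : ℝ) = 1 - M.condH p θ p := by rw [condH_self hR hθ hp hp0, sub_self]
    refine Subset.antisymm ?_ ?_
    · rintro _ ⟨b, hb, rfl⟩
      refine ⟨?_, hanti (left_mem_Icc.2 hd.2) hb hb.1⟩
      rw [e]; exact hanti hb (right_mem_Icc.2 hd.2) hb.2
    · rw [e]; exact intermediate_value_Icc' hd.2 hcont
  have hder : ∀ b ∈ Icc d p, HasDerivWithinAt (fun b => 1 - M.condH p θ b)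
      (-(M.h θ b / (M.H θ p - M.H θ 0))) (Icc d p) b := fun b hb => by
    have hb' := hB (Icc_subset_Icc_right hp.2 (hsub hb))
    exact ((((M.h_deriv θ hθ b hb'.1 hb'.2).mono
      ((hsub.trans (Icc_subset_Icc_right hp.2)).trans hB)).sub_const _).div_const _).const_sub 1
  -- Substitution `s = 1 - condH p θ b`, which is decreasing in `b`; its density `h` over the
  -- conditional mass cancels the prefactor of `Φ`.
  have key := integral_image_eq_integral_deriv_smul_of_antitoneOn measurableSet_Icc hder hanti
    (fun s => M.J p θ (M.bq p θ s))
  have hq := (condH_mem hR hθ hp hp0 hd).2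
  rw [himg, integral_Icc_eq_integral_Ioc, ← intervalIntegral.integral_of_le (by linarith)] at key
  rw [Φ, key, intervalIntegral.integral_of_le hd.2, ← integral_Icc_eq_integral_Ioc,
    ← integral_const_mul]
  refine setIntegral_congr_fun measurableSet_Icc fun b hb => ?_
  have hne : M.H θ p - M.H θ 0 ≠ 0 := by linarith
  simp only [bq_condH hR hθ hp hp0 (hsub hb), smul_eq_mul, neg_neg]
  field_simp

theorem Φ_condH_mul (hR : R ∈ M.B) (hθ : θ ∈ Icc M.θlo M.θhi) (hp : p ∈ Icc 0 R)
    (hp0 : 0 < p) {d : ℝ} (hd : d ∈ Icc 0 p) :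
    M.Φ p θ (1 - M.condH p θ d) * M.f θ = ∫ b in d..p, (M.virt R θ b - p) * M.weight R θ b := by
  rw [Φ_condH hR hθ hp hp0 hd, ← intervalIntegral.integral_mul_const]
  refine intervalIntegral_congr_Icc hd.2 fun b hb => ?_
  have hb' : b ∈ Icc 0 R := ⟨hd.1.trans hb.1, hb.2.trans hp.2⟩
  simp only [weight_eq hθ hb', J_eq_virt hθ hb']
  ring

theorem condH_mul (hR : R ∈ M.B) (hθ : θ ∈ Icc M.θlo M.θhi) (hp : p ∈ Icc 0 R)
    (hp0 : 0 < p) (d : ℝ) :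
    (M.H θ p - M.H θ 0) * (1 - M.condH p θ d) = M.H θ p - M.H θ d := by
  have := H_strictMonoOn hR (hp0.trans_le hp.2) hθ ⟨le_rfl, hR.1⟩ hp hp0
  have hne : M.H θ p - M.H θ 0 ≠ 0 := by linarith
  rw [condH]; field_simp; ring

variable (M R) in
/-- The largest profit from serving type `θ` at service price `p`. -/
def maxProfit (p θ : ℝ) : ℝ :=
  (∫ b in (0 : ℝ)..p, max (M.virt R θ b - p) 0 * M.weight R θ b) / M.f θ

theorem maxProfit_mul (hθ : θ ∈ Icc M.θlo M.θhi) : M.maxProfit R p θ * M.f θ =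
    ∫ b in (0 : ℝ)..p, max (M.virt R θ b - p) 0 * M.weight R θ b :=
  div_mul_cancel₀ _ (M.f_pos θ hθ).ne'

theorem continuous_excess_snd (hR : R ∈ M.B) (hR0 : 0 < R) (c θ : ℝ) :
    Continuous fun b => max (M.virt R θ b - c) 0 * M.weight R θ b :=
  (continuous_excess hR hR0 c).comp (Continuous.prodMk_right θ)

theorem integrableOn_maxProfit (hR : R ∈ M.B) (hR0 : 0 < R) (p : ℝ) :
    IntegrableOn (fun θ => M.maxProfit R p θ * M.f θ) M.Θ := by
  have hc : Continuous fun θ => ∫ b in (0 : ℝ)..p,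
      max (M.virt R θ b - p) 0 * M.weight R θ b :=
    intervalIntegral.continuous_parametric_intervalIntegral_of_continuous'
      (f := fun θ b => max (M.virt R θ b - p) 0 * M.weight R θ b) (continuous_excess hR hR0 p) _ _
  exact (hc.continuousOn.congr fun θ hθ => maxProfit_mul hθ).integrableOn_Icc

/-- Every quantity corresponds to a deductible `d`. On `[d, p]` the net virtual value is below its
positive part, and `[0, d]` contributes nonnegatively to the latter. -/
theorem Φ_le_maxProfit (hR : R ∈ M.B) (hθ : θ ∈ Icc M.θlo M.θhi) (hp : p ∈ Icc 0 R)
    (hp0 : 0 < p) {q : ℝ} (hq : q ∈ Icc (0 : ℝ) 1) : M.Φ p θ q ≤ M.maxProfit R p θ := by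
  have hR0 := hp0.trans_le hp.2
  obtain ⟨d, hd, rfl⟩ := exists_condH_eq hR hθ hp hp0 hq
  refine le_of_mul_le_mul_right ?_ (M.f_pos θ hθ)
  rw [Φ_condH_mul hR hθ hp hp0 hd, maxProfit_mul hθ]
  have hc := continuous_excess_snd hR hR0 p θ
  have hv : Continuous (M.virt R θ) := (continuous_virt hR hR0).comp (Continuous.prodMk_right θ)
  have hw : Continuous (M.weight R θ) := (continuous_weight hR hR0).comp (Continuous.prodMk_right θ)
  rw [← intervalIntegral.integral_add_adjacent_intervals (hc.intervalIntegrable 0 d)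
    (hc.intervalIntegrable d p)]
  have h1 := intervalIntegral.integral_nonneg (μ := volume) hd.1 fun b _ =>
    mul_nonneg (le_max_right (M.virt R θ b - p) 0) (weight_pos hR θ b).le
  have h2 := intervalIntegral.integral_mono_on hd.2
    (((hv.sub continuous_const).mul hw).intervalIntegrable (μ := volume) d p) (hc.intervalIntegrable d p)
    fun b _ => mul_le_mul_of_nonneg_right (le_max_left (M.virt R θ b - p) 0) (weight_pos hR θ b).le
  exact h2.trans (le_add_of_nonneg_left h1)

theorem Φ_cutoff (hR : R ∈ M.B) (hJ : ∀ p : ℝ, ∀ θ ∈ M.Θ, StrictMonoOn (M.J p θ) M.B)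
    (hθ : θ ∈ Icc M.θlo M.θhi) (hp : p ∈ Icc 0 R) (hp0 : 0 < p) :
    M.Φ p θ (1 - M.condH p θ (M.cutoff R p p θ)) = M.maxProfit R p θ := by
  have hR0 := hp0.trans_le hp.2
  have hd : M.cutoff R p p θ ∈ Icc 0 p := crossing_mem hp0.le _ _
  refine mul_right_cancel₀ (M.f_pos θ hθ).ne' ?_
  rw [Φ_condH_mul hR hθ hp hp0 hd, maxProfit_mul hθ, ← integral_ite_lt_mul hd,
    intervalIntegral.integral_of_le hp0.le, intervalIntegral.integral_of_le hp0.le]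
  refine setIntegral_congr_fun measurableSet_Ioc fun b hb => ?_
  simp only [cutoff, crossing_lt_iff (continuous_virt hR hR0) (virt_strictMonoOn hR hJ) hp.2 hb]
  by_cases h : p < M.virt R θ b
  · simp [h, max_eq_left (sub_nonneg.2 h.le)]
  · simp [h, max_eq_right (sub_nonpos.2 (not_lt.1 h))]

/-- Weak duality against the cutoff profile: a dual feasible pair `(w, m)` is tested at the
quantities of that profile, where `Φ` equals `maxProfit`. After integration `m` multiplies zero
because the profile satisfies (EQ). -/
theorem solvesDual_maxProfit (hβ : M.β = 0) (hR : R ∈ M.B)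
    (hJ : ∀ p : ℝ, ∀ θ ∈ M.Θ, StrictMonoOn (M.J p θ) M.B) (hp : p ∈ Icc 0 R) (hp0 : 0 < p)
    (h : servedMass M.θlo M.θhi R (M.virt R) (M.weight R) p p = M.RS p) :
    M.SolvesDual p (M.maxProfit R p) 0 := by
  have hR0 := hp0.trans_le hp.2
  have hopt := isOptimalDeductible_cutoff hβ hR hR0 hJ hp h
  refine ⟨⟨integrableOn_maxProfit hR hR0 p, ?_⟩, fun w m hw => ?_⟩
  · filter_upwards [ae_restrict_mem measurableSet_Icc] with θ hθ q hq
    rw [zero_mul, add_zero]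
    exact Φ_le_maxProfit hR hθ hp hp0 hq
  · have hle := M.θlo_lt_θhi.le
    have iv : IntervalIntegrable (fun θ => M.maxProfit R p θ * M.f θ) volume M.θlo M.θhi :=
      (intervalIntegrable_iff_integrableOn_Icc_of_le hle).2 (integrableOn_maxProfit hR hR0 p)
    have iw : IntervalIntegrable (fun θ => w θ * M.f θ) volume M.θlo M.θhi :=
      (intervalIntegrable_iff_integrableOn_Icc_of_le hle).2 hw.1
    have iD := intervalIntegrable_H_comp hR hopt.2.1.1.measurable_deductible
      fun θ hθ => Icc_subset_Icc_right hp.2 (hopt.1 θ hθ)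
    have ig : IntervalIntegrable (fun θ => (M.H θ p - M.H θ (M.cutoff R p p θ)) * M.f θ)
        volume M.θlo M.θhi := by
      refine (iD.sub (intervalIntegrable_base hR hp)).congr fun θ _ => ?_
      ring
    have iF : IntervalIntegrable M.f volume M.θlo M.θhi :=
      intervalIntegrable_of_continuousOn_Θ M.f_cont
    have hmono := intervalIntegral.integral_mono_ae_restrict hle
      (iv.add ((ig.sub (iF.const_mul (M.RS p))).const_mul m)) iw (by
        filter_upwards [hw.2, ae_restrict_mem measurableSet_Icc] with θ hθw hθ
        have hd : M.cutoff R p p θ ∈ Icc 0 p := crossing_mem hp0.le _ _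
        have hc := condH_mem hR hθ hp hp0 hd
        have := hθw _ ⟨sub_nonneg.2 hc.2, sub_le_self 1 hc.1⟩
        rw [Φ_cutoff hR hJ hθ hp hp0, condH_mul hR hθ hp hp0] at this
        have h2 := mul_le_mul_of_nonneg_right this (M.f_pos θ hθ).le
        linarith)
    have hd := hopt.2.1.2
    rw [insuredDemand_deductible hR hR0 hp hopt.1] at hd
    rw [intervalIntegral.integral_add iv ((ig.sub (iF.const_mul (M.RS p))).const_mul m),
      intervalIntegral.integral_const_mul, intervalIntegral.integral_sub ig
        (iF.const_mul (M.RS p)), intervalIntegral.integral_const_mul, hd, M.f_integral] at hmono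
    linarith

end Dual
end InsuranceModel

/-! ### Existence and comparison of clearing levels -/

namespace InsuranceModel

variable {M : InsuranceModel} {R : ℝ}

/-- An agent seeks the service when the valuation exceeds the price or the virtual value exceeds the
level; raising both shrinks this set. -/
theorem servedMass_add_baseDemand_le (hR : R ∈ M.B) (hR0 : 0 < R) {p q c d : ℝ}
    (hp : p ∈ Icc 0 R) (hq : q ∈ Icc 0 R) (hpq : p ≤ q) (hcd : c ≤ d) :
    servedMass M.θlo M.θhi R (M.virt R) (M.weight R) q d + M.baseDemand q ≤
      servedMass M.θlo M.θhi R (M.virt R) (M.weight R) p c + M.baseDemand p := by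
  have hv := continuous_virt hR hR0
  have hw := continuous_weight hR hR0
  have hm := continuous_massAt hR hR0
  have iw : ∀ p, Integrable (fun z : ℝ × ℝ => if z.2 ≤ p then M.weight R z.1 z.2 else 0)
      (rectMeasure M.θlo M.θhi R) := fun p =>
    integrable_ite_rectMeasure (P := fun z => z.2 ≤ p) (φ := fun z => M.weight R z.1 z.2)
      hw.integrable_rectMeasure (measurableSet_snd_le p)
  have hb := baseDemand_sub hR hR0 hp hq
  rw [← intervalIntegral.integral_interval_sub_left (hm.intervalIntegrable 0 q)
    (hm.intervalIntegrable 0 p), ← integral_weight_rect hR hR0 hp,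
    ← integral_weight_rect hR hR0 hq] at hb
  -- The difference of base demands is the mass between `p` and `q`. Placing the two rectangle
  -- masses on opposite sides leaves a pointwise inequality of integrands.
  have key : servedMass M.θlo M.θhi R (M.virt R) (M.weight R) q d +
      ∫ z, (if z.2 ≤ p then M.weight R z.1 z.2 else 0) ∂rectMeasure M.θlo M.θhi R ≤
      servedMass M.θlo M.θhi R (M.virt R) (M.weight R) p c +
      ∫ z, (if z.2 ≤ q then M.weight R z.1 z.2 else 0) ∂rectMeasure M.θlo M.θhi R := by
    rw [servedMass, servedMass, ← integral_add (integrable_served hv hw q d) (iw p),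
      ← integral_add (integrable_served hv hw p c) (iw q)]
    refine integral_mono ((integrable_served hv hw q d).add (iw p))
      ((integrable_served hv hw p c).add (iw q)) fun z => ?_
    have h0 := (weight_pos hR z.1 z.2).le
    by_cases h1 : z.2 ≤ p
    · have h2 := h1.trans hpq
      by_cases h3 : d < M.virt R z.1 z.2
      · simp [h1, h2, h3, hcd.trans_lt h3]
      · by_cases h4 : c < M.virt R z.1 z.2 <;> simp [h1, h2, h3, h4, h0]
    · by_cases h2 : z.2 ≤ q
      · by_cases h3 : d < M.virt R z.1 z.2 <;> simp [h1, h2, h3, h0]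
      · simp [h1, h2]
  linarith

theorem IsNoCoveragePrice.RS_eq_zero {p : ℝ} (h : M.IsNoCoveragePrice p) : M.RS p = 0 := by
  have := h.2
  simp only [demand, insuredDemand, zero_mul, intervalIntegral.integral_zero, zero_add] at this
  rw [RS, this, sub_self]

theorem IsFullCoveragePrice.S_eq (hR : R ∈ M.B) (h : M.IsFullCoveragePrice R) :
    M.S R = M.baseDemand 0 := by
  have h0 : (0 : ℝ) ∈ Icc 0 R := ⟨le_rfl, h.1.le⟩
  have hRR : R ∈ Icc 0 R := ⟨h.1.le, le_rfl⟩
  have hx : M.IsMonotoneAllocation fun _ _ => 1 :=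
    ⟨measurable_const, fun θ _ => ⟨fun b _ => by simp, fun b _ b' _ _ => le_rfl⟩⟩
  rw [← h.2, demand, insuredDemand_eq hR h.1 hx hRR]
  simp only [one_mul]
  rw [integral_weight_rect hR h.1 hRR, ← baseDemand_sub hR h.1 h0 hRR, sub_add_cancel]

/-- Residual supply is zero at `pN` and grows, hence is nonnegative; it is at most the whole mass
below `p` because `S p` does not exceed full-coverage demand `S R`. -/
theorem exists_clearing {pN : ℝ} (hJ : ∀ p : ℝ, ∀ θ ∈ M.Θ, StrictMonoOn (M.J p θ) M.B)
    (hpN : M.IsNoCoveragePrice pN) (hR : R ∈ M.B) (hpF : M.IsFullCoveragePrice R) {p : ℝ}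
    (hp : p ∈ Icc pN R) :
    ∃ c ∈ Function.uncurry (M.virt R) '' (Icc M.θlo M.θhi ×ˢ Icc 0 p),
      servedMass M.θlo M.θhi R (M.virt R) (M.weight R) p c = M.RS p := by
  have hR0 := hpF.1
  have hpR : p ∈ Icc 0 R := ⟨hpN.1.le.trans hp.1, hp.2⟩
  have hNR : pN ∈ Icc 0 R := ⟨hpN.1.le, hp.1.trans hp.2⟩
  refine exists_servedMass_eq M.θlo_lt_θhi (continuous_virt hR hR0) (continuous_weight hR hR0)
    (virt_strictMonoOn hR hJ) (hpN.1.trans_le hp.1) ?_ ?_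
  · have h1 := hpN.RS_eq_zero
    have h2 := M.S_strictMono.monotoneOn hNR.1 hpR.1 hp.1
    have h3 := baseDemand_sub hR hR0 hNR hpR
    have h4 := intervalIntegral.integral_nonneg (μ := volume) hp.1 fun b _ => massAt_nonneg hR b
    rw [RS] at h1 ⊢
    linarith
  · rw [integral_weight_rect hR hR0 hpR, ← baseDemand_sub hR hR0 ⟨le_rfl, hR0.le⟩ hpR,
      ← hpF.S_eq hR, RS]
    linarith [M.S_strictMono.monotoneOn hpR.1 hR0.le hp.2]

/-- Settles a benchmark at `pN`: if level `p` serves no mass, no virtual value at `p` exceeds `p`,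
so the excess vanishes along with `RS`. -/
theorem margin_eq_zero_of_RS_eq_zero (hR : R ∈ M.B) (hR0 : 0 < R) {p : ℝ} (hp : p ∈ Icc 0 R)
    (hp0 : 0 < p) (hRS : M.RS p = 0)
    (h : servedMass M.θlo M.θhi R (M.virt R) (M.weight R) p p = M.RS p) :
    M.margin R p p = 0 := by
  have hv := continuous_virt hR hR0
  have hw := continuous_weight hR hR0
  have hle : ∀ θ ∈ Icc M.θlo M.θhi, M.virt R θ p ≤ p := by
    intro θ hθ
    by_contra! hlt
    -- Any level above `virt θ p` would do: both served masses are zero, yet this virtual value lies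
    -- strictly between the two levels.
    have hd : p ≤ M.virt R θ p + 1 := by linarith
    have heq : servedMass M.θlo M.θhi R (M.virt R) (M.weight R) p p =
        servedMass M.θlo M.θhi R (M.virt R) (M.weight R) p (M.virt R θ p + 1) := by
      refine le_antisymm ?_ (servedMass_antitone hv hw (weight_pos hR) p hd)
      rw [h, hRS]
      exact servedMass_nonneg (weight_pos hR) _ _
    have := not_between_of_servedMass_eq M.θlo_lt_θhi hv hw (weight_pos hR) hp0 hp.2 hd heq hθ
      (right_mem_Icc.2 hp0.le) hlt
    linarith
  have h0 : M.excessAt R p p = 0 := by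
    refine (intervalIntegral_congr_Icc (v := fun _ => 0) M.θlo_lt_θhi.le fun θ hθ => ?_).trans
      intervalIntegral.integral_zero
    rw [max_eq_right (sub_nonpos.2 (hle θ hθ)), zero_mul]
  rw [margin, h0, hRS]; ring

end InsuranceModel

end

/-! ### The proposition -/

theorem mainTheorem6 (M : InsuranceModel)
    (hβ : M.β = 0)
    (hJ : ∀ p : ℝ, ∀ θ ∈ M.Θ, StrictMonoOn (M.J p θ) M.B)
    (hJ1 : ∀ θ ∈ M.Θ, AntitoneOn (M.J1 θ) M.B)
    (hH : ∀ θ ∈ M.Θ, ConcaveOn ℝ M.B (M.H θ))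
    (pN pF pU : ℝ)
    (hpN : M.IsNoCoveragePrice pN) (hpF : M.IsFullCoveragePrice pF) (hpFB : pF ∈ M.B)
    (hpU_mem : pU ∈ Set.Icc pN pF) (hpU : M.IsPriceTakingBenchmark pU) :
    -- zero is an optimal multiplier of the equilibrium constraint at the benchmark
    (∃ v : ℝ → ℝ, M.SolvesDual pU v 0) ∧
    -- the profit function is differentiable (one-sidedly at the two end points)
    DifferentiableOn ℝ M.profit (Set.Icc pN pF) ∧
    (∃ D : ℝ → ℝ, M.IsOptimalDeductible pU D) ∧
    ∀ D : ℝ → ℝ, M.IsOptimalDeductible pU D →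
      -- the derivative of the profit at an interior benchmark
      (pN < pU → pU < pF →
        HasDerivAt M.profit (M.surplusExtraction pU D - M.costEffect pU D) pU) ∧
      -- comparison of the derivative below and above the benchmark
      (∀ p ∈ Set.Icc pN pF, p < pU →
        M.surplusExtraction pU D - M.costEffect pU D <
          derivWithin M.profit (Set.Icc pN pF) p) ∧
      (∀ p ∈ Set.Icc pN pF, pU < p →
        derivWithin M.profit (Set.Icc pN pF) p <
          M.surplusExtraction pU D - M.costEffect pU D) ∧
      -- location of the profit-maximizing price
      ∀ pstar : ℝ, M.SolvesSecondStage pN pF pstar →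
        (M.costEffect pU D < M.surplusExtraction pU D →
          (pU < pF → pU < pstar) ∧ (pU = pF → pstar = pU)) ∧
        (M.surplusExtraction pU D < M.costEffect pU D → pU < pF → pstar < pU) ∧
        (M.surplusExtraction pU D = M.costEffect pU D → pstar = pU) := by
  have hF0 := hpF.1
  have hsub : Icc pN pF ⊆ Icc 0 pF := Icc_subset_Icc_left hpN.1.le
  have hU0 : 0 < pU := hpN.1.trans_le hpU_mem.1
  have hUm := hsub hpU_mem
  have hclU := hpU.servedMass_eq hβ hpFB hF0 hJ hUm
  -- A nondegenerate price interval is needed for `derivWithin` to be determined.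
  have hNF : pN < pF := by
    have hlt : M.S pN < M.S pF := by
      have h1 := hpN.RS_eq_zero
      have h2 := InsuranceModel.baseDemand_sub hpFB hF0 ⟨le_rfl, hF0.le⟩
        (hsub (left_mem_Icc.2 (hpU_mem.1.trans hpU_mem.2)))
      have h3 := intervalIntegral.intervalIntegral_pos_of_pos
        ((InsuranceModel.continuous_massAt hpFB hF0).intervalIntegrable 0 pN)
        (InsuranceModel.massAt_pos hpFB hF0) hpN.1
      rw [InsuranceModel.RS] at h1
      rw [hpF.S_eq hpFB]
      linarith
    exact (M.S_strictMono.lt_iff_lt hpN.1.le hF0.le).1 hlt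
  choose! c hc hcl using fun p (hp : p ∈ Icc pN pF) =>
    InsuranceModel.exists_clearing hJ hpN hpFB hpF hp
  have hc_cont : ContinuousOn c (Icc pN pF) :=
    continuousOn_clearing M.θlo_lt_θhi (InsuranceModel.continuous_virt hpFB hF0)
      (InsuranceModel.continuous_weight hpFB hF0) (InsuranceModel.virt_strictMonoOn hpFB hJ)
      (InsuranceModel.weight_pos hpFB) hpN.1
      ((InsuranceModel.continuousOn_RS hpFB hF0).mono hsub) fun p hp => ⟨hc p hp, hcl p hp⟩
  have hprofit_le : ∀ p ∈ Icc pN pF, ∀ d,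
      M.profit p ≤ M.surplus pF p d + (d - p) * M.RS p := fun p hp d =>
    InsuranceModel.profit_le hβ hpFB hF0 (hsub hp)
      ⟨_, (InsuranceModel.isOptimalDeductible_cutoff hβ hpFB hF0 hJ (hsub hp) (hcl p hp)).2.1⟩ d
  have hderiv : ∀ p ∈ Icc pN pF,
      HasDerivWithinAt M.profit (M.margin pF p (c p)) (Icc pN pF) p := fun p hp =>
    hasDerivWithinAt_of_envelope (W := fun p d => M.surplus pF p d + (d - p) * M.RS p) hc_cont
      (fun d p hp => (InsuranceModel.hasDerivWithinAt_bound hpFB hF0 (hsub hp) d).mono hsub)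
      ((InsuranceModel.continuousOn_margin hpFB hF0).mono (prod_mono_left hsub))
      (fun p hp => InsuranceModel.profit_eq hβ hpFB hF0 hJ (hsub hp) (hcl p hp)) hprofit_le hp
  have hderiv' : ∀ p ∈ Icc pN pF,
      derivWithin M.profit (Icc pN pF) p = M.margin pF p (c p) := fun p hp =>
    (hderiv p hp).derivWithin (uniqueDiffOn_Icc hNF p hp)
  have hanti := InsuranceModel.margin_self_strictAntiOn hpFB hF0 hJ1
  have hbelow : ∀ p ∈ Icc pN pF, p < pU → M.margin pF pU pU < M.margin pF p (c p) := by
    intro p hp hlt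
    refine (hanti (hsub hp) hUm hlt).trans_le
      (InsuranceModel.margin_self_le hpFB hF0 (hsub hp).1 ?_)
    -- If `c p < p`, both price and level would be lower than at `pU`, so total demand, hence
    -- supply, would be at least that at `pU`, although `p < pU`.
    by_contra! hcp
    have h1 := InsuranceModel.servedMass_add_baseDemand_le hpFB hF0 (hsub hp) hUm hlt.le
      (hcp.le.trans hlt.le)
    rw [hclU, hcl p hp, InsuranceModel.RS, InsuranceModel.RS] at h1
    linarith [M.S_strictMono (hsub hp).1 hUm.1 hlt]
  have habove : ∀ p ∈ Icc pN pF, pU < p → M.margin pF p (c p) < M.margin pF pU pU := by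
    intro p hp hlt
    refine (InsuranceModel.margin_le_self hpFB hF0 (hsub hp).1 ?_).trans_lt
      (hanti hUm (hsub hp) hlt)
    by_contra! hcp
    have h1 := InsuranceModel.servedMass_add_baseDemand_le hpFB hF0 hUm (hsub hp) hlt.le
      (hlt.le.trans hcp.le)
    rw [hclU, hcl p hp, InsuranceModel.RS, InsuranceModel.RS] at h1
    linarith [M.S_strictMono hUm.1 (hsub hp).1 hlt]
  -- The selected `c pU` may differ from `pU` when `pU` lies outside the range of virtual values.
  -- The bound with level fixed at `pU` still touches the profit from above at `pU`, so at an
  -- interior point the derivatives agree.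
  have hinterior : pN < pU → pU < pF → HasDerivAt M.profit (M.margin pF pU pU) pU := by
    intro h1 h2
    have hnhds := Icc_mem_nhds h1 h2
    have d1 := (hderiv pU hpU_mem).hasDerivAt hnhds
    have d2 := (InsuranceModel.hasDerivWithinAt_bound hpFB hF0 hUm pU).hasDerivAt
      (Icc_mem_nhds hU0 h2)
    have hmax : IsLocalMax (M.profit - fun q => M.surplus pF q pU + (pU - q) * M.RS q) pU := by
      filter_upwards [hnhds] with q hq
      have e := InsuranceModel.profit_eq hβ hpFB hF0 hJ hUm hclU
      have := hprofit_le q hq pU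
      simp only [Pi.sub_apply]
      linarith
    have := hmax.hasDerivAt_eq_zero (d1.sub d2)
    exact d1.congr_deriv (sub_eq_zero.1 this)
  have hcontP : ContinuousOn M.profit (Icc pN pF) := fun p hp => (hderiv p hp).continuousWithinAt
  have hderivI : ∀ p, pN < p → p < pF → deriv M.profit p = M.margin pF p (c p) := fun p h1 h2 =>
    ((hderiv p ⟨h1.le, h2.le⟩).hasDerivAt (Icc_mem_nhds h1 h2)).deriv
  have hmono : 0 ≤ M.margin pF pU pU → StrictMonoOn M.profit (Icc pN pU) := by
    intro he
    refine strictMonoOn_of_deriv_pos (convex_Icc _ _)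
      (hcontP.mono (Icc_subset_Icc_right hpU_mem.2)) fun x hx => ?_
    rw [interior_Icc] at hx
    rw [hderivI x hx.1 (hx.2.trans_le hpU_mem.2)]
    exact he.trans_lt (hbelow x ⟨hx.1.le, hx.2.le.trans hpU_mem.2⟩ hx.2)
  have hmono' : M.margin pF pU pU ≤ 0 → StrictAntiOn M.profit (Icc pU pF) := by
    intro he
    refine strictAntiOn_of_deriv_neg (convex_Icc _ _)
      (hcontP.mono (Icc_subset_Icc_left hpU_mem.1)) fun x hx => ?_
    rw [interior_Icc] at hx
    rw [hderivI x (hpU_mem.1.trans_lt hx.1) hx.2]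
    exact (habove x ⟨hpU_mem.1.trans hx.1.le, hx.2.le⟩ hx.1).trans_le he
  refine ⟨⟨_, InsuranceModel.solvesDual_maxProfit hβ hpFB hJ hUm hU0 hclU⟩,
    fun p hp => (hderiv p hp).differentiableWithinAt,
    ⟨_, InsuranceModel.isOptimalDeductible_cutoff hβ hpFB hF0 hJ hUm hclU⟩, fun D hD => ?_⟩
  have hSE := hD.surplusExtraction_sub_costEffect hβ hpFB hF0 hJ hUm hU0 hclU
  rw [hSE]
  refine ⟨hinterior, fun p hp hlt => by rw [hderiv' p hp]; exact hbelow p hp hlt,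
    fun p hp hlt => by rw [hderiv' p hp]; exact habove p hp hlt, fun pstar hstar => ?_⟩
  have hge : 0 ≤ M.margin pF pU pU → pU ≤ pstar := fun he => by
    by_contra! hlt
    exact absurd (hstar.2 pU hpU_mem)
      (not_le.2 (hmono he ⟨hstar.1.1, hlt.le⟩ (right_mem_Icc.2 hpU_mem.1) hlt))
  have hle : M.margin pF pU pU ≤ 0 → pstar ≤ pU := fun he => by
    by_contra! hlt
    exact absurd (hstar.2 pU hpU_mem)
      (not_le.2 (hmono' he (left_mem_Icc.2 hpU_mem.2) ⟨hlt.le, hstar.1.2⟩ hlt))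
  -- Rules out a maximum at `pU` when the forces differ: the interior case is Fermat's rule, and at
  -- `pU = pN` the margin vanishes anyway.
  have hcrit : pU < pF → pstar = pU → M.margin pF pU pU = 0 := by
    rintro hlt rfl
    rcases hpU_mem.1.eq_or_lt with h | h
    · subst h
      exact InsuranceModel.margin_eq_zero_of_RS_eq_zero hpFB hF0 hUm hU0 hpN.RS_eq_zero hclU
    · refine IsLocalMax.hasDerivAt_eq_zero ?_ (hinterior h hlt)
      filter_upwards [Icc_mem_nhds h hlt] with q hq using hstar.2 q hq
  refine ⟨fun h => ⟨fun hlt => ?_, fun heq => ?_⟩, fun h hlt => ?_, fun h => ?_⟩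
  · refine lt_of_le_of_ne (hge (by linarith)) fun he => ?_
    linarith [hcrit hlt he.symm]
  · exact le_antisymm (heq ▸ hstar.1.2) (hge (by linarith))
  · refine lt_of_le_of_ne (hle (by linarith)) fun he => ?_
    linarith [hcrit hlt he]
  · exact le_antisymm (hle (by linarith)) (hge (by linarith))
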